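/- **Setting.** Let $(X,d)$ be a Gromov hyperbolic metric space (not assumed proper or geodesic), i.e. with $\langle x|y\rangle_z=\frac12[d(x,z)+d(y,z)-d(x,y)]$ there is $c$ such that $\langle x|z\rangle_w\ge\min(\langle x|y\rangle_w,\langle y|z\rangle_w)-c$ for all $x,y,z,w\in X$. Let $o\in X$, and let $\partial X$ be the Gromov boundary (Gromov sequences modulo equivalence), with the Gromov products extended by $$\langle\xi|\eta\rangle_z=\inf\Big\{\liminf_{n,m\to\infty}\langle x_n|y_m\rangle_z: (x_n)\in\xi,(y_m)\in\eta\Big\},\qquad \langle y|\xi\rangle_z=\inf\Big\{\liminf_{n\to\infty}\langle x_n|y\rangle_z:(x_n)\in\xi\Big\}.$$ Give $X\sqcup\partial X$ the topology in which $S$ is open iff $S\cap X$ is open in $X$ and for each $\xi\in S\cap\partial X$ there is $t$ with $\{y\in X\sqcup\partial X:\langle y|\xi\rangle_o>t\}\subset S$. Let $b>1$ be such that there is a visual metric $D$ on $\partial X$, i.e. a metric with $C^{-1}b^{-\langle\xi|\eta\rangle_o}\le D(\xi,\eta)\le C\,b^{-\langle\xi|\eta\rangle_o}$ for some $C>0$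 and all $\xi,\eta\in\partial X$; fix such a $D$, and let $B(\xi,r)$ be the closed $D$-balls. Let $G$ be a group of isometries (bijective, extended to $X\sqcup\partial X$) of $X$ that is strongly discrete (for every $r>0$ only finitely many $g\in G$ satisfy $d(o,g(o))\le r$) and of general type (it contains two loxodromic isometries with disjoint sets of fixed points in $\partial X$). Here $g$ is loxodromic if it has two distinct fixed points $g_+,g_-\in\partial X$ such that for every neighborhood $U$ of $g_-$, $g^n\to g_+$ uniformly on $\partial X\setminus U$, and for every neighborhood $V$ of $g_+$, $g^{-n}\to g_-$ uniformly on $\partial X\setminus V$. Let $\Lambda\subset\partial X$ be the limit set of $G$ (the limits in $\partial X$ of sequences in $G(o)$), and for $g\in G$, $\eta\in\partial X$ let $$g'(\eta)=b^{\mathcal B_\eta(o,g^{-1}(o))},\qquad \mathcal B_\eta(y,z)=\langle z|\eta\rangle_y-\langle y|\eta\rangle_z .$$ Assume that the Poincaré exponent $\delta=\inf\{s\ge0:\sum_{g\in G}b^{-s\,d(o,g(o))}<\infty\}$ is finite, and let $\mu$ be a Borel probability measure on $\partial X$ with $\mu(\partial X\setminus\Lambda)=0$ which is - $\delta$-quasiconformal: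 there is $C>0$ with $C^{-1}\int_A (g')^\delta\,d\mu\le\mu(g(A))\le C\int_A(g')^\delta\,d\mu$ for all $g\in G$ and all Borel $A\subset\partial X$; and - ergodic: every $G$-invariant Borel set $A\subset\partial X$ has $\mu(A)=0$ or $\mu(\partial X\setminus A)=0$. Let $\xi\in\partial X$ with $\mu(\{\xi\})=0$, and let $\Phi:(0,\infty)\to(0,\infty)$ be a function such that $t\mapsto t\Phi(t)$ is nonincreasing. Let $\mathrm{WA}_{\Phi,\xi}$ be the set of $\eta\in\Lambda$ such that for every $K>0$ there is $g\in G$ with $D(g(\xi),\eta)\le\Phi(K b^{d(o,g(o))})$. For $K>0$ consider the series $$\text{(D)}\quad \sum_{g\in G}b^{-\delta d(o,g(o))}\,\mu\Big(B\big(\xi,\;b^{d(o,g(o))}\Phi(Kb^{d(o,g(o))})\big)\Big),\qquad \text{(C)}\quad \sum_{g\in G}(g'(\xi))^{\delta}\,\mu\Big(B\big(\xi,\;\Phi(Kb^{d(o,g(o))})/g'(\xi)\big)\Big).$$ **Theorem (generalized Khinchin theorem).** - (i) If (D) diverges for all $K>0$, then $\mu(\mathrm{WA}_{\Phi,\xi})=1$.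 - (iiA) If (C) converges for some $K>0$, then $\mu(\mathrm{WA}_{\Phi,\xi})=0$. - (iiB) If $\xi$ is a bounded parabolic point of $G$ and (D) converges for some $K>0$, then $\mu(\mathrm{WA}_{\Phi,\xi})=0$. Here, with $G_\xi$ the stabilizer of $\xi$ in $G$, the point $\xi$ is bounded parabolic if $\xi\in\Lambda$, the orbit $G_\xi(o)$ is unbounded, there is $C>0$ with $C^{-1}\le g'(\xi)\le C$ for all $g\in G_\xi$, and there is a set $S\subset X\sqcup\partial X$ with $\xi\notin\overline S$ and $G(o)\subset\bigcup_{h\in G_\xi}h(S)$. -/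

import Mathlib

open Set Filter Topology MeasureTheory
open scoped ENNReal NNReal

noncomputable section

namespace GromovKhinchin

/-- The Gromov product `⟨x|y⟩_z`. -/
def gromovProduct {X : Type*} [MetricSpace X] (x y z : X) : ℝ :=
  (dist x z + dist y z - dist x y) / 2

/-- Gromov hyperbolic metric space: Gromov's four point inequality holds up to an
additive constant. -/
class GromovHyperbolic (X : Type*) [MetricSpace X] : Prop where
  gromov_ineq : ∃ c : ℝ, ∀ x y z w : X,
    min (gromovProduct x y w) (gromovProduct y z w) - c ≤ gromovProduct x z w

/-- `⟨x_n|x_m⟩_o → ∞` as `n, m → ∞`. This does not depend on the base point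
(see `isGromovSeq_iff`), so all base points are used at once. -/
def IsGromovSeq {X : Type*} [MetricSpace X] (x : ℕ → X) : Prop :=
  ∀ o : X, Tendsto (fun p : ℕ × ℕ => gromovProduct (x p.1) (x p.2) o) atTop atTop

/-- `⟨x_n|y_n⟩_o → ∞` as `n → ∞`, for one or all base points (see `gromovEquiv_iff`). -/
def GromovEquiv {X : Type*} [MetricSpace X] (x y : ℕ → X) : Prop :=
  ∀ o : X, Tendsto (fun n => gromovProduct (x n) (y n) o) atTop atTop

theorem gromovProduct_base {X : Type*} [MetricSpace X] (x y z w : X) :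
    gromovProduct x y z - dist z w ≤ gromovProduct x y w := by
  unfold gromovProduct
  have h1 := dist_triangle x w z
  have h2 := dist_triangle y w z
  have h3 := dist_comm z w
  linarith

theorem isGromovSeq_iff {X : Type*} [MetricSpace X] (o : X) (x : ℕ → X) :
    IsGromovSeq x ↔
      Tendsto (fun p : ℕ × ℕ => gromovProduct (x p.1) (x p.2) o) atTop atTop :=
  ⟨fun h => h o, fun h w => tendsto_atTop_mono (fun _ => gromovProduct_base _ _ o w)
    (tendsto_atTop_add_const_right _ (-dist o w) h)⟩

theorem gromovEquiv_iff {X : Type*} [MetricSpace X] (o : X) (x y : ℕ → X) :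
    GromovEquiv x y ↔ Tendsto (fun n => gromovProduct (x n) (y n) o) atTop atTop :=
  ⟨fun h => h o, fun h w => tendsto_atTop_mono (fun _ => gromovProduct_base _ _ o w)
    (tendsto_atTop_add_const_right _ (-dist o w) h)⟩

theorem gromovProduct_isometry {X : Type*} [MetricSpace X] (g : X ≃ᵢ X) (x y z : X) :
    gromovProduct (g x) (g y) z = gromovProduct x y (g.symm z) := by
  have h : ∀ a : X, dist (g a) z = dist a (g.symm z) := fun a => by
    rw [← g.dist_eq a (g.symm z), g.apply_symm_apply]
  simp only [gromovProduct, h, g.dist_eq]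

/-- Gromov sequences in `X`. -/
def GromovSeq (X : Type*) [MetricSpace X] : Type _ := {x : ℕ → X // IsGromovSeq x}

/-- Equivalence of Gromov sequences. -/
instance gromovSetoid (X : Type*) [MetricSpace X] [GromovHyperbolic X] :
    Setoid (GromovSeq X) where
  r x y := GromovEquiv x.1 y.1
  iseqv :=
    { refl := fun x o =>
        (x.2 o).comp (tendsto_id.prodMk tendsto_id |>.mono_right prod_atTop_atTop_eq.le)
      symm := fun {x y} h o => by
        refine (h o).congr fun n => ?_
        simp only [gromovProduct, dist_comm (x.1 n) (y.1 n)]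
        ring
      trans := fun {x y z} hxy hyz o => by
        obtain ⟨c, hc⟩ := GromovHyperbolic.gromov_ineq (X := X)
        refine tendsto_atTop_mono (fun n => hc (x.1 n) (y.1 n) (z.1 n) o) ?_
        refine tendsto_atTop_add_const_right _ (-c) ?_
        exact tendsto_atTop.2 fun b => by
          filter_upwards [tendsto_atTop.1 (hxy o) b, tendsto_atTop.1 (hyz o) b] with n h1 h2
          exact le_min h1 h2 }

/-- The Gromov boundary `∂X`. -/
def GromovBoundary (X : Type*) [MetricSpace X] [GromovHyperbolic X] : Type _ :=
  Quotient (gromovSetoid X)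

/-- The boundary point represented by a Gromov sequence. -/
def GromovBoundary.mk {X : Type*} [MetricSpace X] [GromovHyperbolic X] (x : GromovSeq X) :
    GromovBoundary X :=
  Quotient.mk (gromovSetoid X) x

/-- The Gromov closure `X ⊔ ∂X`. -/
inductive GromovClosure (X : Type*) [MetricSpace X] [GromovHyperbolic X] : Type _
  | inner (x : X) : GromovClosure X
  | bdry (ξ : GromovBoundary X) : GromovClosure X

/-- The image of a Gromov sequence under an isometry. -/
def seqMap {X : Type*} [MetricSpace X] (g : X ≃ᵢ X) (x : GromovSeq X) : GromovSeq X :=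
  ⟨fun n => g (x.1 n), fun o => by simpa only [gromovProduct_isometry] using x.2 (g.symm o)⟩

/-- The extension of an isometry to the Gromov boundary. -/
def boundaryMap {X : Type*} [MetricSpace X] [GromovHyperbolic X] (g : X ≃ᵢ X) :
    GromovBoundary X → GromovBoundary X :=
  Quotient.map' (s₁ := gromovSetoid X) (s₂ := gromovSetoid X) (seqMap g) fun x y h o => by
    change Tendsto (fun n => gromovProduct (g (x.1 n)) (g (y.1 n)) o) atTop atTop
    simpa only [gromovProduct_isometry] using h (g.symm o)

/-- The extension of an isometry to the Gromov closure. -/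
def closureMap {X : Type*} [MetricSpace X] [GromovHyperbolic X] (g : X ≃ᵢ X) :
    GromovClosure X → GromovClosure X
  | .inner x => .inner (g x)
  | .bdry ξ => .bdry (boundaryMap g ξ)

/-- `⟨ξ|η⟩_z` for two boundary points: the infimum, over all sequences representing them, of
the lower limit of the Gromov products. It is `∞` exactly when `ξ = η`. -/
def boundaryProduct {X : Type*} [MetricSpace X] [GromovHyperbolic X]
    (ξ η : GromovBoundary X) (z : X) : ℝ≥0∞ :=
  ⨅ (x : GromovSeq X) (_ : GromovBoundary.mk x = ξ)
    (y : GromovSeq X) (_ : GromovBoundary.mk y = η),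
    liminf (fun p : ℕ × ℕ => ENNReal.ofReal (gromovProduct (x.1 p.1) (y.1 p.2) z)) atTop

/-- `⟨y|ξ⟩_z` for a point `y` of `X` and a boundary point `ξ`; always finite. -/
def mixedProduct {X : Type*} [MetricSpace X] [GromovHyperbolic X]
    (y : X) (ξ : GromovBoundary X) (z : X) : ℝ≥0∞ :=
  ⨅ (x : GromovSeq X) (_ : GromovBoundary.mk x = ξ),
    liminf (fun n : ℕ => ENNReal.ofReal (gromovProduct (x.1 n) y z)) atTop

/-- `⟨y|ξ⟩_z` for a point `y` of the Gromov closure and a boundary point `ξ`. -/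
def closureProduct {X : Type*} [MetricSpace X] [GromovHyperbolic X] :
    GromovClosure X → GromovBoundary X → X → ℝ≥0∞
  | .inner y, ξ, z => mixedProduct y ξ z
  | .bdry η, ξ, z => boundaryProduct η ξ z

/-- The Busemann function `B_ξ(y, z) = ⟨z|ξ⟩_y - ⟨y|ξ⟩_z`. -/
def busemann {X : Type*} [MetricSpace X] [GromovHyperbolic X]
    (ξ : GromovBoundary X) (y z : X) : ℝ :=
  (mixedProduct z ξ y).toReal - (mixedProduct y ξ z).toReal

/-- The topology of the Gromov closure: `S` is open if `S ∩ X` is open and if every boundary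
point `ξ` of `S` has some `N_t(ξ) = {y : ⟨y|ξ⟩_o > t}` contained in `S`. -/
@[reducible]
def gromovClosureTopology {X : Type*} [MetricSpace X] [GromovHyperbolic X] (o : X) :
    TopologicalSpace (GromovClosure X) where
  IsOpen S := IsOpen {x : X | GromovClosure.inner x ∈ S} ∧
    ∀ ξ : GromovBoundary X, GromovClosure.bdry ξ ∈ S →
      ∃ t : ℝ≥0, {y | (t : ℝ≥0∞) < closureProduct y ξ o} ⊆ S
  isOpen_univ := ⟨by simp, fun _ _ => ⟨0, subset_univ _⟩⟩
  isOpen_inter := fun S T hS hT => ⟨hS.1.inter hT.1, fun ξ hξ => by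
    obtain ⟨s, hs⟩ := hS.2 ξ hξ.1
    obtain ⟨t, ht⟩ := hT.2 ξ hξ.2
    refine ⟨max s t, fun y hy => ⟨hs ?_, ht ?_⟩⟩
    · exact lt_of_le_of_lt (ENNReal.coe_le_coe.2 (le_max_left s t)) hy
    · exact lt_of_le_of_lt (ENNReal.coe_le_coe.2 (le_max_right s t)) hy⟩
  isOpen_sUnion := fun F hF => ⟨by
    have : {x : X | GromovClosure.inner x ∈ ⋃₀ F}
        = ⋃ S ∈ F, {x : X | GromovClosure.inner x ∈ S} := by
      ext x; simp
    rw [this]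
    exact isOpen_biUnion fun S hS => (hF S hS).1, fun ξ ⟨S, hS, hξ⟩ => by
    obtain ⟨t, ht⟩ := (hF S hS).2 ξ hξ
    exact ⟨t, ht.trans (subset_sUnion_of_mem hS)⟩⟩

/-- The metric of `∂X` is a visual metric with respect to `b` and `o`:
`D(ξ, η) ≍ b ^ (-⟨ξ|η⟩_o)`. (For `ξ = η` both sides are zero, and for `ξ ≠ η` the Gromov
product is finite.) -/
def IsVisualMetric (X : Type*) [MetricSpace X] [GromovHyperbolic X]
    [MetricSpace (GromovBoundary X)] (b : ℝ) (o : X) : Prop :=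
  ∃ C : ℝ, 0 < C ∧ ∀ ξ η : GromovBoundary X, ξ ≠ η →
    C⁻¹ * b ^ (-(boundaryProduct ξ η o).toReal) ≤ dist ξ η ∧
      dist ξ η ≤ C * b ^ (-(boundaryProduct ξ η o).toReal)

/-- Strong discreteness (metrical properness) of a group of isometries. -/
def StronglyDiscrete {X : Type*} [MetricSpace X] (o : X) (G : Subgroup (X ≃ᵢ X)) : Prop :=
  ∀ r : ℝ, 0 < r → {g : X ≃ᵢ X | g ∈ G ∧ dist o (g o) ≤ r}.Finite

/-- `g` is loxodromic: it has an attracting fixed point `p` and a repelling fixed point `q ≠ p`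
in `∂X`. -/
def IsLoxodromic {X : Type*} [MetricSpace X] [GromovHyperbolic X]
    [MetricSpace (GromovBoundary X)] (g : X ≃ᵢ X) : Prop :=
  ∃ p q : GromovBoundary X, p ≠ q ∧ boundaryMap g p = p ∧ boundaryMap g q = q ∧
    (∀ U ∈ 𝓝 q, TendstoUniformlyOn (fun n : ℕ => (boundaryMap g)^[n]) (fun _ => p) atTop Uᶜ) ∧
    (∀ U ∈ 𝓝 p, TendstoUniformlyOn (fun n : ℕ => (boundaryMap g⁻¹)^[n]) (fun _ => q) atTop Uᶜ)

/-- `G` is of general type: it contains two loxodromic isometries without a common fixed point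
in `∂X`. -/
def IsGeneralType {X : Type*} [MetricSpace X] [GromovHyperbolic X]
    [MetricSpace (GromovBoundary X)] (G : Subgroup (X ≃ᵢ X)) : Prop :=
  ∃ g₁ ∈ G, ∃ g₂ ∈ G, IsLoxodromic g₁ ∧ IsLoxodromic g₂ ∧
    Disjoint (Function.fixedPoints (boundaryMap g₁)) (Function.fixedPoints (boundaryMap g₂))

/-- The limit set `Λ(G)`: limits in `∂X` of sequences in the orbit `G(o)`. -/
def limitSet {X : Type*} [MetricSpace X] [GromovHyperbolic X] (o : X)
    (G : Subgroup (X ≃ᵢ X)) : Set (GromovBoundary X) :=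
  {η | ∃ g : ℕ → X ≃ᵢ X, (∀ n, g n ∈ G) ∧
    Tendsto (fun n => GromovClosure.inner (g n o)) atTop
      (@nhds _ (gromovClosureTopology o) (GromovClosure.bdry η))}

/-- The Poincaré series `∑_{g ∈ G} b ^ (-s d(o, g o))`. -/
def poincareSeries {X : Type*} [MetricSpace X] (b : ℝ) (o : X) (G : Subgroup (X ≃ᵢ X))
    (s : ℝ) : ℝ≥0∞ :=
  ∑' g : G, ENNReal.ofReal (b ^ (-s * dist o ((g : X ≃ᵢ X) o)))

/-- The Poincaré exponent, the infimum of the `s ≥ 0` for which the Poincaré series converges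
(`∞` if there are none). -/
def poincareExponent {X : Type*} [MetricSpace X] (b : ℝ) (o : X) (G : Subgroup (X ≃ᵢ X)) :
    ℝ≥0∞ :=
  ⨅ (s : ℝ≥0) (_ : poincareSeries b o G s < ∞), (s : ℝ≥0∞)

/-- The derivative `g'(ξ) = b ^ B_ξ(o, g⁻¹ o)` of an isometry at a boundary point. -/
def boundaryDeriv {X : Type*} [MetricSpace X] [GromovHyperbolic X] (b : ℝ) (o : X)
    (g : X ≃ᵢ X) (ξ : GromovBoundary X) : ℝ :=
  b ^ busemann ξ o (g⁻¹ o)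

/-- `μ` is `s`-quasiconformal: `μ(g(A)) ≍ ∫_A (g')^s dμ`, with a constant independent of the
element `g` of `G` and of the Borel set `A`. -/
def IsQuasiconformal {X : Type*} [MetricSpace X] [GromovHyperbolic X]
    [MeasurableSpace (GromovBoundary X)] (b : ℝ) (o : X) (G : Subgroup (X ≃ᵢ X)) (s : ℝ)
    (μ : Measure (GromovBoundary X)) : Prop :=
  ∃ C : ℝ≥0, ∀ g ∈ G, ∀ A : Set (GromovBoundary X), MeasurableSet A →
    μ (boundaryMap g '' A) ≤ C * ∫⁻ η in A, ENNReal.ofReal (boundaryDeriv b o g η ^ s) ∂μ ∧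
    ∫⁻ η in A, ENNReal.ofReal (boundaryDeriv b o g η ^ s) ∂μ ≤ C * μ (boundaryMap g '' A)

/-- `μ` is ergodic: every `G`-invariant Borel set is null or conull. -/
def IsErgodic {X : Type*} [MetricSpace X] [GromovHyperbolic X]
    [MeasurableSpace (GromovBoundary X)] (G : Subgroup (X ≃ᵢ X))
    (μ : Measure (GromovBoundary X)) : Prop :=
  ∀ A : Set (GromovBoundary X), MeasurableSet A → (∀ g ∈ G, boundaryMap g '' A = A) →
    μ A = 0 ∨ μ Aᶜ = 0

/-- `ξ` is a parabolic fixed point of `G`: the orbit of `o` under the stabilizer `G_ξ` is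
unbounded, and `g'(ξ) ≍ 1` for `g ∈ G_ξ`. -/
def IsParabolicPoint {X : Type*} [MetricSpace X] [GromovHyperbolic X] (b : ℝ) (o : X)
    (G : Subgroup (X ≃ᵢ X)) (ξ : GromovBoundary X) : Prop :=
  ¬ Bornology.IsBounded {x : X | ∃ g ∈ G, boundaryMap g ξ = ξ ∧ g o = x} ∧
    ∃ C : ℝ, 0 < C ∧ ∀ g ∈ G, boundaryMap g ξ = ξ →
      C⁻¹ ≤ boundaryDeriv b o g ξ ∧ boundaryDeriv b o g ξ ≤ C

/-- A subset `S` of the Gromov closure is `ξ`-bounded if `ξ` is not in the closure of `S`. -/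
def IsPointBounded {X : Type*} [MetricSpace X] [GromovHyperbolic X] (o : X)
    (ξ : GromovBoundary X) (S : Set (GromovClosure X)) : Prop :=
  GromovClosure.bdry ξ ∉ @closure _ (gromovClosureTopology o) S

/-- `ξ` is a bounded parabolic point of `G`: a parabolic limit point such that
`G(o) ⊆ G_ξ(S)` for some `ξ`-bounded set `S`. -/
def IsBoundedParabolicPoint {X : Type*} [MetricSpace X] [GromovHyperbolic X] (b : ℝ) (o : X)
    (G : Subgroup (X ≃ᵢ X)) (ξ : GromovBoundary X) : Prop :=
  ξ ∈ limitSet o G ∧ IsParabolicPoint b o G ξ ∧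
    ∃ S : Set (GromovClosure X), IsPointBounded o ξ S ∧
      ∀ g ∈ G, ∃ h ∈ G, boundaryMap h ξ = ξ ∧ GromovClosure.inner (g o) ∈ closureMap h '' S

/-- The set `WA_{Φ,ξ}` of `Φ,ξ`-well approximable points of the limit set. -/
def wellApproximable {X : Type*} [MetricSpace X] [GromovHyperbolic X]
    [MetricSpace (GromovBoundary X)] (b : ℝ) (o : X) (G : Subgroup (X ≃ᵢ X))
    (ξ : GromovBoundary X) (Φ : ℝ → ℝ) : Set (GromovBoundary X) :=
  {η | η ∈ limitSet o G ∧ ∀ K : ℝ, 0 < K → ∃ g ∈ G,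
    dist (boundaryMap g ξ) η ≤ Φ (K * b ^ dist o (g o))}

/-- The series `∑_g b^(-δ d(o, g o)) μ(B(ξ, b^(d(o, g o)) Φ(K b^(d(o, g o)))))`. -/
def khinchinSeries {X : Type*} [MetricSpace X] [GromovHyperbolic X]
    [MetricSpace (GromovBoundary X)] [MeasurableSpace (GromovBoundary X)]
    (b : ℝ) (o : X) (G : Subgroup (X ≃ᵢ X)) (δ : ℝ) (μ : Measure (GromovBoundary X))
    (ξ : GromovBoundary X) (Φ : ℝ → ℝ) (K : ℝ) : ℝ≥0∞ :=
  ∑' g : G, ENNReal.ofReal (b ^ (-δ * dist o ((g : X ≃ᵢ X) o))) *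
    μ (Metric.closedBall ξ
      (b ^ dist o ((g : X ≃ᵢ X) o) * Φ (K * b ^ dist o ((g : X ≃ᵢ X) o))))

/-- The series `∑_g g'(ξ)^δ μ(B(ξ, Φ(K b^(d(o, g o))) / g'(ξ)))`. -/
def khinchinDerivSeries {X : Type*} [MetricSpace X] [GromovHyperbolic X]
    [MetricSpace (GromovBoundary X)] [MeasurableSpace (GromovBoundary X)]
    (b : ℝ) (o : X) (G : Subgroup (X ≃ᵢ X)) (δ : ℝ) (μ : Measure (GromovBoundary X))
    (ξ : GromovBoundary X) (Φ : ℝ → ℝ) (K : ℝ) : ℝ≥0∞ :=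
  ∑' g : G, ENNReal.ofReal (boundaryDeriv b o (g : X ≃ᵢ X) ξ ^ δ) *
    μ (Metric.closedBall ξ
      (Φ (K * b ^ dist o ((g : X ≃ᵢ X) o)) / boundaryDeriv b o (g : X ≃ᵢ X) ξ))

end GromovKhinchin

end

namespace GromovKhinchin

/-! ### Coarse calculus of Gromov products and Busemann functions -/

section Products

variable {X : Type*} [MetricSpace X]

/-! Write l_g = b^d(o,go). The geometry rests on the coarse identity g'(η) l_g ≍ b^(2⟨g⁻¹o|η⟩_o):
through it and the visual metric, Gromov's inequality becomes a set of estimates on derivatives and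
distances, collected in `BoundaryGeometry`. Since tΦ(t) is nonincreasing, enlarging K by a factor c
≥ 1 divides Φ by at least c, so bounded factors are always absorbed in K
(`mul_le_of_antitoneOn_mul`).

Convergence. The derivative g' is almost constant on the g-preimage of B(gξ, Φ(K'l_g)) once K' is
large (`preimage_ball`), so by quasiconformality the measure of this ball is at most a constant
times a term of (C), and Borel–Cantelli applies. A point off the null orbit of ξ that lies in only
finitely many of these balls leaves all of them for a larger K. If ξ is bounded parabolic, g may be
replaced by gh with h in G_ξ: this keeps gξ, increases l_g by at most a bounded factor, and makes
g'(ξ) l_g bounded. On such elements g'(ξ) ≍ 1/l_g, so (D) dominates (C).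

Divergence. Up to the limit set, WA is the intersection of the decreasing sets U_K = `approximable`.
This intersection is invariant, hence null or conull. Suppose it is null, so that μ(U_K) is as small
as desired for large K. Restrict to the set T = `contracting` of g with g'(ξ) l_g ≤ M. For g in T,
the image P_g of a fixed ball B(ξ,r₀) has size ≲ 1/l_g and measure ≳ l_g^(-δ) μ(B(ξ,r₀)), while the
image E_g of the ball of radius l_g Φ(K l_g) has size ≲ Φ(K l_g) and measure ≳ the term of (D). The
part of the family lying below u is carried by u⁻¹ into some U_K₁ with tiny measure, so it has at
most half the measure of P_u. The packing inequality `sum_measure_le_of_packing` converts this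
smallness at every u into ∑ μ(E_g) ≤ 2μ(∂X), without doubling of μ. It needs separated centres gξ;
the elements discarded to achieve separation cost a convergent geometric series (`exists_sum_le`),
because strong discreteness bounds their number in each shell and δ > 0. Finally, for a fixed f with
fξ ≠ ξ, either g or gf is in T, so (D) converges for some K, contradicting divergence. General type
supplies both f and δ > 0. -/

theorem gromovProduct_comm (x y z : X) : gromovProduct x y z = gromovProduct y x z := by
  simp only [gromovProduct, dist_comm x y]; ring

theorem gromovProduct_nonneg (x y z : X) : 0 ≤ gromovProduct x y z := by
  have := dist_triangle_right x y z
  simp only [gromovProduct]; linarith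

theorem gromovProduct_le_dist (x y z : X) : gromovProduct x y z ≤ dist y z := by
  have := dist_triangle x y z
  simp only [gromovProduct]; linarith

theorem dist_inv_apply (g : X ≃ᵢ X) (x y : X) : dist x (g⁻¹ y) = dist (g x) y := by
  rw [← g.dist_eq x (g⁻¹ y)]
  congr 1
  exact g.apply_symm_apply y

variable [GromovHyperbolic X]

theorem exists_gromov_const (X : Type*) [MetricSpace X] [GromovHyperbolic X] :
    ∃ c : ℝ, 0 ≤ c ∧ ∀ x y z w : X,
      min (gromovProduct x y w) (gromovProduct y z w) ≤ gromovProduct x z w + c := by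
  obtain ⟨c, hc⟩ := GromovHyperbolic.gromov_ineq (X := X)
  refine ⟨max c 0, le_max_right _ _, fun x y z w => ?_⟩
  have := hc x y z w
  have := le_max_left c 0
  linarith

theorem exists_rep (η : GromovBoundary X) : ∃ x : GromovSeq X, GromovBoundary.mk x = η :=
  Quotient.exists_rep η

theorem boundaryMap_mk (g : X ≃ᵢ X) (x : GromovSeq X) :
    boundaryMap g (GromovBoundary.mk x) = GromovBoundary.mk (seqMap g x) := rfl

theorem tendsto_of_mk_eq {x y : GromovSeq X} (h : GromovBoundary.mk x = GromovBoundary.mk y)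
    (o : X) : Tendsto (fun p : ℕ × ℕ => gromovProduct (x.1 p.1) (y.1 p.2) o) atTop atTop := by
  obtain ⟨c, -, hc⟩ := exists_gromov_const X
  have hxy : GromovEquiv x.1 y.1 := Quotient.exact h
  have h2 : Tendsto (fun p : ℕ × ℕ => gromovProduct (x.1 p.2) (y.1 p.2) o) atTop atTop :=
    (hxy o).comp (tendsto_snd.mono_left prod_atTop_atTop_eq.ge)
  refine tendsto_atTop.2 fun B => ?_
  filter_upwards [tendsto_atTop.1 (x.2 o) (B + c), tendsto_atTop.1 h2 (B + c)] with p hp hq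
  have := hc (x.1 p.1) (x.1 p.2) (y.1 p.2) o
  have := le_min hp hq
  linarith

theorem mk_eq_of_tendsto {x y : GromovSeq X} (o : X)
    (h : Tendsto (fun n => gromovProduct (x.1 n) (y.1 n) o) atTop atTop) :
    GromovBoundary.mk x = GromovBoundary.mk y :=
  Quotient.sound ((gromovEquiv_iff o _ _).2 h)

theorem abs_toReal_sub_le {m : ℝ≥0∞} {v a : ℝ} (hv : 0 ≤ v) (ha : 0 ≤ a)
    (h1 : ENNReal.ofReal (v - a) ≤ m) (h2 : m ≤ ENNReal.ofReal (v + a)) :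
    |m.toReal - v| ≤ a := by
  have hm : m ≠ ∞ := ne_top_of_le_ne_top ENNReal.ofReal_ne_top h2
  have h3 := ENNReal.toReal_mono ENNReal.ofReal_ne_top h2
  rw [ENNReal.toReal_ofReal (by positivity)] at h3
  rw [ENNReal.ofReal_le_iff_le_toReal hm] at h1
  exact abs_sub_le_iff.2 ⟨by linarith, by linarith⟩

theorem liminf_le_of_eventually_le {ι : Type*} {l : Filter ι} [l.NeBot] {f : ι → ℝ≥0∞}
    {a : ℝ≥0∞} (h : ∀ᶠ i in l, f i ≤ a) : liminf f l ≤ a :=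
  (liminf_le_liminf h).trans (liminf_const a).le

/-- Replaces the infimum of lower limits by the value far along any single representative, up to a
uniform error; coarse identities can then be checked on points of X. -/
theorem eventually_mixedProduct (X : Type*) [MetricSpace X] [GromovHyperbolic X] :
    ∃ C : ℝ, 0 ≤ C ∧ ∀ (x : GromovSeq X) (y z : X), ∀ᶠ n in atTop,
      |gromovProduct (x.1 n) y z - (mixedProduct y (GromovBoundary.mk x) z).toReal| ≤ C := by
  obtain ⟨c, hc0, hc⟩ := exists_gromov_const X
  refine ⟨3 * c, by positivity, fun x y z => ?_⟩
  have key : ∀ x x' : GromovSeq X, GromovBoundary.mk x = GromovBoundary.mk x' →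
      ∀ᶠ p : ℕ × ℕ in atTop,
        gromovProduct (x.1 p.1) y z ≤ gromovProduct (x'.1 p.2) y z + c ∧
        gromovProduct (x'.1 p.2) y z ≤ gromovProduct (x.1 p.1) y z + c := by
    intro x x' h
    -- A product with y never exceeds d(y,z). Beyond this threshold the minimum in Gromov's
    -- inequality is therefore the product with y.
    filter_upwards [tendsto_atTop.1 (tendsto_of_mk_eq h z) (dist y z)] with p hp
    have h1 := hc (x.1 p.1) (x'.1 p.2) y z
    have h2 := hc (x'.1 p.2) (x.1 p.1) y z
    have h3 := gromovProduct_le_dist (x.1 p.1) y z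
    have h4 := gromovProduct_le_dist (x'.1 p.2) y z
    rw [min_eq_right (by linarith)] at h1
    rw [gromovProduct_comm (x'.1 p.2) (x.1 p.1), min_eq_right (by linarith)] at h2
    exact ⟨h2, h1⟩
  obtain ⟨⟨N₁, N₂⟩, hN⟩ := eventually_atTop.1 (key x x rfl)
  set v := gromovProduct (x.1 N₂) y z with hv
  have hx : ∀ n ≥ N₁, gromovProduct (x.1 n) y z ≤ v + c ∧ v ≤ gromovProduct (x.1 n) y z + c :=
    fun n hn => hN (n, N₂) ⟨hn, le_rfl⟩
  have hx' : ∀ x' : GromovSeq X, GromovBoundary.mk x' = GromovBoundary.mk x →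
      ∀ᶠ n in atTop, gromovProduct (x'.1 n) y z ≤ v + 2 * c ∧
        v - 2 * c ≤ gromovProduct (x'.1 n) y z := by
    intro x' h
    obtain ⟨⟨M₁, M₂⟩, hM⟩ := eventually_atTop.1 (key x x' h.symm)
    filter_upwards [eventually_ge_atTop M₂] with n hn
    have h1 := hM (max M₁ N₁, n) ⟨le_max_left _ _, hn⟩
    have h2 := hx (max M₁ N₁) (le_max_right _ _)
    constructor <;> linarith [h1.1, h1.2, h2.1, h2.2]
  have hm : |(mixedProduct y (GromovBoundary.mk x) z).toReal - v| ≤ 2 * c := by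
    refine abs_toReal_sub_le (gromovProduct_nonneg _ _ _) (by positivity) ?_ ?_
    · refine le_iInf₂ fun x' h => le_liminf_of_le (by isBoundedDefault) ?_
      filter_upwards [hx' x' h] with n hn
      exact ENNReal.ofReal_le_ofReal hn.2
    · refine iInf₂_le_of_le x rfl (liminf_le_of_eventually_le ?_)
      filter_upwards [hx' x rfl] with n hn
      exact ENNReal.ofReal_le_ofReal hn.1
  filter_upwards [eventually_ge_atTop N₁] with n hn
  have h2 := hx n hn
  have := abs_sub_le_iff.1 hm
  exact abs_sub_le_iff.2 ⟨by linarith, by linarith⟩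

/-- Distinctness is what keeps the products bounded, so that products along equivalent sequences
eventually win every minimum in Gromov's inequality. -/
theorem eventually_boundaryProduct (X : Type*) [MetricSpace X] [GromovHyperbolic X] :
    ∃ C : ℝ, 0 ≤ C ∧ ∀ (x y : GromovSeq X) (z : X),
      GromovBoundary.mk x ≠ GromovBoundary.mk y → ∀ᶠ n in atTop,
      |gromovProduct (x.1 n) (y.1 n) z -
        (boundaryProduct (GromovBoundary.mk x) (GromovBoundary.mk y) z).toReal| ≤ C := by
  obtain ⟨c, hc0, hc⟩ := exists_gromov_const X
  refine ⟨8 * c, by positivity, fun x y z hne => ?_⟩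
  have hc3 : ∀ p q r s : X, ∀ t : ℝ, t ≤ gromovProduct p q z → t ≤ gromovProduct q r z →
      t ≤ gromovProduct r s z → t ≤ gromovProduct p s z + 2 * c := by
    intro p q r s t h1 h2 h3
    have h4 := (le_min h1 h2).trans (hc p q r z)
    have h5 := hc p r s z
    rcases min_cases (gromovProduct p r z) (gromovProduct r s z) with h | h <;> linarith
  -- Inequivalence only bounds the product infinitely often on the diagonal. Two uses of Gromov's
  -- inequality spread the bound to all large pairs, at the cost of 2c.
  obtain ⟨B, hB⟩ : ∃ B, ∃ᶠ n in atTop, gromovProduct (x.1 n) (y.1 n) z < B := by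
    by_contra! h
    refine hne (mk_eq_of_tendsto z (tendsto_atTop.2 fun B => ?_))
    exact h B
  have hbound : ∀ᶠ p : ℕ × ℕ in atTop, gromovProduct (x.1 p.1) (y.1 p.2) z ≤ B + 2 * c := by
    obtain ⟨⟨N₁, N₂⟩, hN⟩ := eventually_atTop.1
      (tendsto_atTop.1 (tendsto_of_mk_eq (rfl : GromovBoundary.mk x = _) z) (B + 2 * c))
    obtain ⟨⟨M₁, M₂⟩, hM⟩ := eventually_atTop.1
      (tendsto_atTop.1 (tendsto_of_mk_eq (rfl : GromovBoundary.mk y = _) z) (B + 2 * c))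
    obtain ⟨n, hn, hnB⟩ := frequently_atTop.1 hB (max N₁ M₂)
    filter_upwards [eventually_ge_atTop ((N₂, M₁) : ℕ × ℕ)] with p hp
    by_contra! h
    have h1 := hc3 (x.1 n) (x.1 p.1) (y.1 p.2) (y.1 n) (B + 2 * c)
      (hN (n, p.1) ⟨(le_max_left _ _).trans hn, hp.1⟩) h.le
      (hM (p.2, n) ⟨hp.2, (le_max_right _ _).trans hn⟩)
    linarith
  have key : ∀ x' y' : GromovSeq X, GromovBoundary.mk x' = GromovBoundary.mk x →
      GromovBoundary.mk y' = GromovBoundary.mk y → ∃ N M : ℕ,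
      ∀ n ≥ N, ∀ m ≥ N, ∀ k ≥ M, ∀ l ≥ M,
        gromovProduct (x.1 n) (y.1 m) z ≤ gromovProduct (x'.1 k) (y'.1 l) z + 2 * c ∧
        gromovProduct (x'.1 k) (y'.1 l) z ≤ gromovProduct (x.1 n) (y.1 m) z + 2 * c := by
    intro x' y' hx hy
    obtain ⟨⟨N₁, N₂⟩, hN⟩ := eventually_atTop.1 hbound
    obtain ⟨⟨M₁, M₂⟩, hM⟩ := eventually_atTop.1
      (tendsto_atTop.1 (tendsto_of_mk_eq hx z) (B + 2 * c + 2 * c + 1))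
    obtain ⟨⟨L₁, L₂⟩, hL⟩ := eventually_atTop.1
      (tendsto_atTop.1 (tendsto_of_mk_eq hy z) (B + 2 * c + 2 * c + 1))
    refine ⟨max (max N₁ N₂) (max M₂ L₂), max M₁ L₁, fun n hn m hm k hk l hl => ?_⟩
    simp only [ge_iff_le, max_le_iff] at hn hm hk hl
    have h1 := hN (n, m) ⟨hn.1.1, hm.1.2⟩
    have h2 := hM (k, n) ⟨hk.1, hn.2.1⟩
    have h3 := hL (l, m) ⟨hl.2, hm.2.2⟩
    simp only at h1 h2 h3
    have h2' := h2
    have h3' := h3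
    rw [gromovProduct_comm] at h2' h3'
    refine ⟨hc3 _ _ _ _ _ (by linarith) le_rfl (by linarith), ?_⟩
    have h4 : gromovProduct (x'.1 k) (y'.1 l) z ≤ B + 2 * c + 2 * c + 1 := by
      by_contra! h
      have := hc3 (x.1 n) (x'.1 k) (y'.1 l) (y.1 m) (B + 2 * c + 2 * c + 1) (by linarith) h.le
        (by linarith)
      linarith
    exact hc3 _ _ _ _ _ (by linarith) le_rfl (by linarith)
  obtain ⟨N, M, hNM⟩ := key x y rfl rfl
  set K := max N M with hK
  set v := gromovProduct (x.1 K) (y.1 K) z with hv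
  have hx' : ∀ x' y' : GromovSeq X, GromovBoundary.mk x' = GromovBoundary.mk x →
      GromovBoundary.mk y' = GromovBoundary.mk y → ∀ᶠ p : ℕ × ℕ in atTop,
        gromovProduct (x'.1 p.1) (y'.1 p.2) z ≤ v + 4 * c ∧
        v - 4 * c ≤ gromovProduct (x'.1 p.1) (y'.1 p.2) z := by
    intro x' y' hx hy
    obtain ⟨N', M', h'⟩ := key x' y' hx hy
    filter_upwards [eventually_ge_atTop ((M', M') : ℕ × ℕ)] with p hp
    have h1 := h' (max N' N) (le_max_left _ _) (max N' N) (le_max_left _ _) p.1 hp.1 p.2 hp.2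
    have h2 := hNM (max N' N) (le_max_right _ _) (max N' N) (le_max_right _ _) K
      (le_max_right _ _) K (le_max_right _ _)
    constructor <;> linarith [h1.1, h1.2, h2.1, h2.2]
  have hm : |(boundaryProduct (GromovBoundary.mk x) (GromovBoundary.mk y) z).toReal - v|
      ≤ 4 * c := by
    refine abs_toReal_sub_le (gromovProduct_nonneg _ _ _) (by positivity) ?_ ?_
    · refine le_iInf₂ fun x' h => le_iInf₂ fun y' h' =>
        le_liminf_of_le (by isBoundedDefault) ?_
      filter_upwards [hx' x' y' h h'] with n hn
      exact ENNReal.ofReal_le_ofReal hn.2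
    · refine iInf₂_le_of_le x rfl (iInf₂_le_of_le y rfl (liminf_le_of_eventually_le ?_))
      filter_upwards [hx' x y rfl rfl] with n hn
      exact ENNReal.ofReal_le_ofReal hn.1
  have hd : Tendsto (fun n : ℕ => (n, n)) atTop atTop :=
    prod_atTop_atTop_eq (α := ℕ) (β := ℕ) ▸ tendsto_id.prodMk tendsto_id
  filter_upwards [hd.eventually (hx' x y rfl rfl)] with n hn
  have := abs_sub_le_iff.1 hm
  exact abs_sub_le_iff.2 ⟨by linarith, by linarith⟩

/-- For a point x of X in place of the boundary point, the difference of the two products defining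
the Busemann function is exactly d(x,y) - d(x,z). -/
theorem eventually_busemann (X : Type*) [MetricSpace X] [GromovHyperbolic X] :
    ∃ C : ℝ, 0 ≤ C ∧ ∀ (x : GromovSeq X) (y z : X), ∀ᶠ n in atTop,
      |busemann (GromovBoundary.mk x) y z - (dist (x.1 n) y - dist (x.1 n) z)| ≤ C := by
  obtain ⟨C, hC, h⟩ := eventually_mixedProduct X
  refine ⟨2 * C, by positivity, fun x y z => ?_⟩
  filter_upwards [h x z y, h x y z] with n h1 h2
  rw [abs_le] at *
  simp only [gromovProduct, busemann, dist_comm z y] at *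
  constructor <;> linarith

theorem abs_busemann_le (X : Type*) [MetricSpace X] [GromovHyperbolic X] :
    ∃ C : ℝ, 0 ≤ C ∧ ∀ (o : X) (g : X ≃ᵢ X) (η : GromovBoundary X),
      |busemann η o (g⁻¹ o)| ≤ dist o (g o) + C := by
  obtain ⟨C, hC, h⟩ := eventually_busemann X
  refine ⟨C, hC, fun o g η => ?_⟩
  obtain ⟨x, rfl⟩ := exists_rep η
  obtain ⟨n, hn⟩ := (h x o (g⁻¹ o)).exists
  have h1 := abs_dist_sub_le o (g⁻¹ o) (x.1 n)
  rw [dist_comm o (x.1 n), dist_comm _ (x.1 n), dist_inv_apply g o, dist_comm (g o)] at h1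
  rw [abs_le] at *
  constructor <;> linarith

theorem busemann_mul (X : Type*) [MetricSpace X] [GromovHyperbolic X] :
    ∃ C : ℝ, 0 ≤ C ∧ ∀ (o : X) (g h : X ≃ᵢ X) (η : GromovBoundary X),
      |busemann η o ((g * h)⁻¹ o) -
        (busemann (boundaryMap h η) o (g⁻¹ o) + busemann η o (h⁻¹ o))| ≤ C := by
  obtain ⟨C, hC, h⟩ := eventually_busemann X
  refine ⟨3 * C, by positivity, fun o g k η => ?_⟩
  obtain ⟨x, rfl⟩ := exists_rep η
  obtain ⟨n, h1, h2, h3⟩ := ((h x o ((g * k)⁻¹ o)).and ((h (seqMap k x) o (g⁻¹ o)).and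
    (h x o (k⁻¹ o)))).exists
  rw [boundaryMap_mk]
  rw [dist_inv_apply] at h1 h2 h3
  change |_ - (dist (x.1 n) o - dist (g (k (x.1 n))) o)| ≤ C at h1
  change |_ - (dist (k (x.1 n)) o - dist (g (k (x.1 n))) o)| ≤ C at h2
  rw [abs_le] at *
  constructor <;> linarith

theorem mk_seqMap_ne {g : X ≃ᵢ X} {x y : GromovSeq X}
    (h : GromovBoundary.mk x ≠ GromovBoundary.mk y) :
    GromovBoundary.mk (seqMap g x) ≠ GromovBoundary.mk (seqMap g y) := by
  intro h'
  refine h (Quotient.sound fun o => ?_)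
  have h1 : GromovEquiv (seqMap g x).1 (seqMap g y).1 := Quotient.exact h'
  have h2 := h1 (g o)
  have h3 : ∀ n, gromovProduct ((seqMap g x).1 n) ((seqMap g y).1 n) (g o)
      = gromovProduct (x.1 n) (y.1 n) o := fun n => by
    simp only [seqMap, gromovProduct, g.dist_eq]
  simpa only [h3] using h2

/-- For points of X the expression inside the absolute value vanishes identically. This is the
source of the geometric mean value theorem. -/
theorem boundaryProduct_map (X : Type*) [MetricSpace X] [GromovHyperbolic X] :
    ∃ C : ℝ, 0 ≤ C ∧ ∀ (o : X) (g : X ≃ᵢ X) (η ζ : GromovBoundary X), η ≠ ζ →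
      |2 * (boundaryProduct (boundaryMap g η) (boundaryMap g ζ) o).toReal +
        busemann η o (g⁻¹ o) + busemann ζ o (g⁻¹ o) - 2 * (boundaryProduct η ζ o).toReal|
        ≤ C := by
  obtain ⟨C, hC, h⟩ := eventually_busemann X
  obtain ⟨C', hC', h'⟩ := eventually_boundaryProduct X
  refine ⟨4 * C' + 2 * C, by positivity, fun o g η ζ hne => ?_⟩
  obtain ⟨x, rfl⟩ := exists_rep η
  obtain ⟨y, rfl⟩ := exists_rep ζ
  obtain ⟨n, h1, h2, h3, h4⟩ := ((h x o (g⁻¹ o)).and ((h y o (g⁻¹ o)).and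
    ((h' x y o hne).and (h' (seqMap g x) (seqMap g y) o (mk_seqMap_ne hne))))).exists
  rw [boundaryMap_mk, boundaryMap_mk]
  rw [dist_inv_apply] at h1 h2
  simp only [gromovProduct, seqMap, g.dist_eq] at h3 h4
  rw [abs_le] at *
  simp only [seqMap] at *
  constructor <;> linarith

/-- B_η(o,g⁻¹o) + d(o,go) is coarsely 2⟨g⁻¹o|η⟩_o. Both inequalities are Gromov's for g⁻¹o, η, ζ,
with η as the middle point in the first and g⁻¹o in the second. -/
theorem busemann_near (X : Type*) [MetricSpace X] [GromovHyperbolic X] :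
    ∃ C : ℝ, 0 ≤ C ∧ ∀ (o : X) (g : X ≃ᵢ X) (η ζ : GromovBoundary X), η ≠ ζ →
      min (busemann η o (g⁻¹ o) + dist o (g o)) (2 * (boundaryProduct η ζ o).toReal) ≤
        busemann ζ o (g⁻¹ o) + dist o (g o) + C ∧
      min (busemann η o (g⁻¹ o)) (busemann ζ o (g⁻¹ o)) + dist o (g o) ≤
        2 * (boundaryProduct η ζ o).toReal + C := by
  obtain ⟨c, hc0, hc⟩ := exists_gromov_const X
  obtain ⟨C, hC, h⟩ := eventually_busemann X
  obtain ⟨C', hC', h'⟩ := eventually_boundaryProduct X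
  refine ⟨2 * c + 2 * C' + 2 * C, by positivity, fun o g η ζ hne => ?_⟩
  obtain ⟨x, rfl⟩ := exists_rep η
  obtain ⟨y, rfl⟩ := exists_rep ζ
  obtain ⟨n, h1, h2, h3⟩ := ((h x o (g⁻¹ o)).and ((h y o (g⁻¹ o)).and (h' x y o hne))).exists
  have h4 := hc (g⁻¹ o) (x.1 n) (y.1 n) o
  have h5 := hc (x.1 n) (g⁻¹ o) (y.1 n) o
  have h6 : dist o (g⁻¹ o) = dist o (g o) := by rw [dist_inv_apply, dist_comm]
  simp only [gromovProduct, dist_comm (g⁻¹ o), h6, dist_comm _ o] at *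
  rw [abs_le] at *
  constructor
  · rcases min_le_iff.1 h4 with h7 | h7
    · exact min_le_of_left_le (by linarith)
    · exact min_le_of_right_le (by linarith)
  · rcases min_le_iff.1 h5 with h7 | h7
    · have := min_le_left (busemann (GromovBoundary.mk x) o (g⁻¹ o))
        (busemann (GromovBoundary.mk y) o (g⁻¹ o))
      linarith
    · have := min_le_right (busemann (GromovBoundary.mk x) o (g⁻¹ o))
        (busemann (GromovBoundary.mk y) o (g⁻¹ o))
      linarith

/-- Gromov's inequality for g⁻¹o, η, h⁻¹o; the distance from g⁻¹o to h⁻¹o is the displacement of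
gh⁻¹. -/
theorem busemann_near_inner (X : Type*) [MetricSpace X] [GromovHyperbolic X] :
    ∃ C : ℝ, 0 ≤ C ∧ ∀ (o : X) (g h : X ≃ᵢ X) (η : GromovBoundary X),
      min (busemann η o (g⁻¹ o) + dist o (g o)) (busemann η o (h⁻¹ o) + dist o (h o)) ≤
        dist o (g o) + dist o (h o) - dist o ((g * h⁻¹) o) + C := by
  obtain ⟨c, hc0, hc⟩ := exists_gromov_const X
  obtain ⟨C, hC, h⟩ := eventually_busemann X
  refine ⟨2 * c + 2 * C, by positivity, fun o g k η => ?_⟩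
  obtain ⟨x, rfl⟩ := exists_rep η
  obtain ⟨n, h1, h2⟩ := ((h x o (g⁻¹ o)).and (h x o (k⁻¹ o))).exists
  have h4 := hc (g⁻¹ o) (x.1 n) (k⁻¹ o) o
  have h6 : dist o (g⁻¹ o) = dist o (g o) := by rw [dist_inv_apply, dist_comm]
  have h7 : dist o (k⁻¹ o) = dist o (k o) := by rw [dist_inv_apply, dist_comm]
  have h8 : dist (g⁻¹ o) (k⁻¹ o) = dist o ((g * k⁻¹) o) := by
    rw [dist_comm, dist_inv_apply, dist_comm]; rfl
  simp only [gromovProduct, h8, dist_comm _ o, h6, h7, dist_comm (g⁻¹ o) (x.1 n)] at h4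
  simp only [dist_comm _ o] at *
  rw [abs_le] at *
  rcases min_le_iff.1 h4 with h7 | h7
  · exact min_le_of_left_le (by linarith)
  · exact min_le_of_right_le (by linarith)

theorem busemann_le_mixedProduct (X : Type*) [MetricSpace X] [GromovHyperbolic X] :
    ∃ C : ℝ, 0 ≤ C ∧ ∀ (o : X) (g : X ≃ᵢ X) (η : GromovBoundary X),
      busemann η o (g⁻¹ o) + dist o (g o) ≤ 2 * (mixedProduct (g⁻¹ o) η o).toReal + C := by
  obtain ⟨C, hC, h⟩ := eventually_busemann X
  obtain ⟨C', hC', h'⟩ := eventually_mixedProduct X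
  refine ⟨2 * C' + C, by positivity, fun o g η => ?_⟩
  obtain ⟨x, rfl⟩ := exists_rep η
  obtain ⟨n, h1, h2⟩ := ((h x o (g⁻¹ o)).and (h' x (g⁻¹ o) o)).exists
  have h6 : dist o (g⁻¹ o) = dist o (g o) := by rw [dist_inv_apply, dist_comm]
  simp only [gromovProduct, dist_comm _ o, h6] at *
  rw [abs_le] at *
  linarith

end Products

/-- The exponential displacement `b ^ d(o, g o)`. -/
noncomputable def expDisp {X : Type*} [MetricSpace X] (b : ℝ) (o : X) (g : X ≃ᵢ X) : ℝ :=
  b ^ dist o (g o)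

/-! ### Derivatives, quasiconformality and the visual metric -/

section Multiplicative

variable {X : Type*} [MetricSpace X] {b : ℝ} {o : X}

theorem expDisp_pos (hb : 1 < b) (g : X ≃ᵢ X) : 0 < expDisp b o g :=
  Real.rpow_pos_of_pos (by linarith) _

theorem one_le_expDisp (hb : 1 < b) (g : X ≃ᵢ X) : 1 ≤ expDisp b o g :=
  Real.one_le_rpow hb.le dist_nonneg

theorem expDisp_inv (g : X ≃ᵢ X) : expDisp b o g⁻¹ = expDisp b o g := by
  rw [expDisp, expDisp, dist_inv_apply, dist_comm]

theorem expDisp_mul_le (hb : 1 < b) (g h : X ≃ᵢ X) :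
    expDisp b o (g * h) ≤ expDisp b o g * expDisp b o h := by
  rw [expDisp, expDisp, expDisp, ← Real.rpow_add (by linarith)]
  refine Real.rpow_le_rpow_of_exponent_le hb.le ?_
  have h1 := dist_triangle o (g o) ((g * h) o)
  have h2 : dist (g o) ((g * h) o) = dist o (h o) := g.dist_eq _ _
  linarith

theorem StronglyDiscrete.finite_expDisp_le {G : Subgroup (X ≃ᵢ X)} (hG : StronglyDiscrete o G)
    (hb : 1 < b) (R : ℝ) : {g : X ≃ᵢ X | g ∈ G ∧ expDisp b o g ≤ R}.Finite := by
  refine (hG (max 1 (Real.logb b R)) (by positivity)).subset fun g hg => ⟨hg.1, ?_⟩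
  have h0 : 0 < expDisp b o g := expDisp_pos hb g
  have h1 := Real.logb_le_logb_of_le hb h0 hg.2
  rw [expDisp, Real.logb_rpow (by linarith) hb.ne'] at h1
  exact h1.trans (le_max_right _ _)

theorem StronglyDiscrete.countable {G : Subgroup (X ≃ᵢ X)} (hG : StronglyDiscrete o G) :
    Countable G := by
  have : (G : Set (X ≃ᵢ X)) = ⋃ n : ℕ, {g : X ≃ᵢ X | g ∈ G ∧ dist o (g o) ≤ n + 1} := by
    ext g
    simp only [SetLike.mem_coe, mem_iUnion, mem_ofPred_eq, exists_and_left, iff_self_and]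
    intro _
    obtain ⟨n, hn⟩ := exists_nat_ge (dist o (g o))
    exact ⟨n, by linarith⟩
  have h : (G : Set (X ≃ᵢ X)).Countable := by
    rw [this]
    exact countable_iUnion fun n => (hG _ (by positivity)).countable
  exact h.to_subtype

variable [GromovHyperbolic X]

theorem boundaryDeriv_pos (hb : 1 < b) (g : X ≃ᵢ X) (η : GromovBoundary X) :
    0 < boundaryDeriv b o g η :=
  Real.rpow_pos_of_pos (by linarith) _

theorem boundaryDeriv_one (η : GromovBoundary X) : boundaryDeriv b o 1 η = 1 := by
  have : (1 : X ≃ᵢ X)⁻¹ o = o := by rw [inv_one]; rfl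
  rw [boundaryDeriv, this, busemann, sub_self, Real.rpow_zero]

theorem boundaryMap_mul (g h : X ≃ᵢ X) (η : GromovBoundary X) :
    boundaryMap (g * h) η = boundaryMap g (boundaryMap h η) := by
  obtain ⟨x, rfl⟩ := exists_rep η
  rfl

theorem boundaryMap_one (η : GromovBoundary X) : boundaryMap (1 : X ≃ᵢ X) η = η := by
  obtain ⟨x, rfl⟩ := exists_rep η
  rfl

theorem boundaryMap_inv_apply (g : X ≃ᵢ X) (η : GromovBoundary X) :
    boundaryMap g⁻¹ (boundaryMap g η) = η := by
  rw [← boundaryMap_mul, inv_mul_cancel, boundaryMap_one]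

theorem boundaryMap_apply_inv (g : X ≃ᵢ X) (η : GromovBoundary X) :
    boundaryMap g (boundaryMap g⁻¹ η) = η := by
  rw [← boundaryMap_mul, mul_inv_cancel, boundaryMap_one]

theorem boundaryMap_injective (g : X ≃ᵢ X) : Function.Injective (boundaryMap g) :=
  Function.LeftInverse.injective (boundaryMap_inv_apply g)

theorem image_boundaryMap (g : X ≃ᵢ X) (A : Set (GromovBoundary X)) :
    boundaryMap g '' A = boundaryMap g⁻¹ ⁻¹' A :=
  congrFun (image_eq_preimage_of_inverse (boundaryMap_inv_apply g) (boundaryMap_apply_inv g)) A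

/-- The derivative is compared only with constants on A, so its measurability never enters. -/
theorem IsQuasiconformal.exists_bounds [MeasurableSpace (GromovBoundary X)]
    {G : Subgroup (X ≃ᵢ X)} {δ : ℝ} {μ : Measure (GromovBoundary X)} (hb : 1 < b)
    (hδ : 0 ≤ δ) (h : IsQuasiconformal b o G δ μ) :
    ∃ Q : ℝ≥0, ∀ g ∈ G, ∀ A : Set (GromovBoundary X), MeasurableSet A → ∀ t : ℝ, 0 ≤ t →
      ((∀ η ∈ A, boundaryDeriv b o g η ≤ t) →
        μ (boundaryMap g '' A) ≤ Q * ENNReal.ofReal (t ^ δ) * μ A) ∧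
      ((∀ η ∈ A, t ≤ boundaryDeriv b o g η) →
        ENNReal.ofReal (t ^ δ) * μ A ≤ Q * μ (boundaryMap g '' A)) := by
  obtain ⟨Q, hQ⟩ := h
  refine ⟨Q, fun g hg A hA t ht => ⟨fun h => ?_, fun h => ?_⟩⟩
  · refine (hQ g hg A hA).1.trans ?_
    rw [mul_assoc]
    gcongr
    rw [← setLIntegral_const]
    refine setLIntegral_mono' hA fun η hη => ENNReal.ofReal_le_ofReal ?_
    exact Real.rpow_le_rpow (boundaryDeriv_pos hb g η).le (h η hη) hδ
  · refine le_trans ?_ (hQ g hg A hA).2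
    rw [← setLIntegral_const]
    refine setLIntegral_mono' hA fun η hη => ENNReal.ofReal_le_ofReal ?_
    exact Real.rpow_le_rpow ht (h η hη) hδ

variable [MetricSpace (GromovBoundary X)]

/-- The coarse geometry of the action of isometries on the boundary with a visual metric:
bounds for the derivative, chain rule, geometric mean value theorem, and the inequality of
Gromov in multiplicative form. -/
structure BoundaryGeometry (X : Type*) [MetricSpace X] [GromovHyperbolic X]
    [MetricSpace (GromovBoundary X)] (b : ℝ) (o : X) (C : ℝ) : Prop where
  one_le : 1 ≤ C
  one_le_deriv_mul : ∀ (g : X ≃ᵢ X) η, 1 ≤ C * (boundaryDeriv b o g η * expDisp b o g)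
  deriv_le : ∀ (g : X ≃ᵢ X) η, boundaryDeriv b o g η ≤ C * expDisp b o g
  deriv_mul_le : ∀ (g h : X ≃ᵢ X) η, boundaryDeriv b o (g * h) η ≤
    C * (boundaryDeriv b o g (boundaryMap h η) * boundaryDeriv b o h η)
  le_deriv_mul : ∀ (g h : X ≃ᵢ X) η,
    boundaryDeriv b o g (boundaryMap h η) * boundaryDeriv b o h η ≤
      C * boundaryDeriv b o (g * h) η
  dist_map_sq_le : ∀ (g : X ≃ᵢ X) η ζ, dist (boundaryMap g η) (boundaryMap g ζ) ^ 2 ≤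
    C * (boundaryDeriv b o g η * boundaryDeriv b o g ζ * dist η ζ ^ 2)
  near : ∀ (g : X ≃ᵢ X) η ζ (s : ℝ), 0 < s → s ≤ boundaryDeriv b o g η * expDisp b o g →
    s * dist η ζ ^ 2 ≤ 1 → s ≤ C * (boundaryDeriv b o g ζ * expDisp b o g)
  near_of_deriv : ∀ (g : X ≃ᵢ X) η ζ (s : ℝ), 0 < s →
    s ≤ boundaryDeriv b o g η * expDisp b o g → s ≤ boundaryDeriv b o g ζ * expDisp b o g →
    s * dist η ζ ^ 2 ≤ C
  near_inner : ∀ (g h : X ≃ᵢ X) η (s : ℝ), 0 < s →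
    s ≤ boundaryDeriv b o g η * expDisp b o g → s ≤ boundaryDeriv b o h η * expDisp b o h →
    s * expDisp b o (g * h⁻¹) ≤ C * (expDisp b o g * expDisp b o h)
  deriv_le_mixedProduct : ∀ (g : X ≃ᵢ X) η, boundaryDeriv b o g η * expDisp b o g ≤
    C * b ^ (2 * (mixedProduct (g⁻¹ o) η o).toReal)

theorem exists_boundaryGeometry (hb : 1 < b) (hvis : IsVisualMetric X b o) :
    ∃ C, BoundaryGeometry X b o C := by
  obtain ⟨c₁, hc₁, h₁⟩ := abs_busemann_le X
  obtain ⟨c₂, hc₂, h₂⟩ := busemann_mul X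
  obtain ⟨c₃, hc₃, h₃⟩ := boundaryProduct_map X
  obtain ⟨c₄, hc₄, h₄⟩ := busemann_near X
  obtain ⟨c₅, hc₅, h₅⟩ := busemann_near_inner X
  obtain ⟨c₆, hc₆, h₆⟩ := busemann_le_mixedProduct X
  obtain ⟨C₀, hC₀, hD⟩ := hvis
  have hb0 : 0 < b := by linarith
  obtain ⟨a, ha0, ha⟩ : ∃ a : ℝ, 0 ≤ a ∧ ∀ η ζ : GromovBoundary X, η ≠ ζ →
      ∃ d, dist η ζ = b ^ d ∧ |d + (boundaryProduct η ζ o).toReal| ≤ a := by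
    refine ⟨|Real.logb b C₀|, abs_nonneg _, fun η ζ hne => ⟨Real.logb b (dist η ζ), ?_, ?_⟩⟩
    · rw [Real.rpow_logb hb0 hb.ne' (dist_pos.2 hne)]
    · obtain ⟨h1, h2⟩ := hD η ζ hne
      have h3 := Real.logb_le_logb_of_le hb (by positivity) h1
      have h4 := Real.logb_le_logb_of_le hb (dist_pos.2 hne) h2
      rw [Real.logb_mul (by positivity) (by positivity), Real.logb_rpow hb0 hb.ne'] at h3 h4
      rw [Real.logb_inv] at h3
      have h5 := le_abs_self (Real.logb b C₀)
      exact abs_le.2 ⟨by linarith, by linarith⟩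
  have mono : ∀ {x y : ℝ}, x ≤ y → b ^ x ≤ b ^ y :=
    fun h => Real.rpow_le_rpow_of_exponent_le hb.le h
  have iff : ∀ {x y : ℝ}, b ^ x ≤ b ^ y ↔ x ≤ y := Real.rpow_le_rpow_left_iff hb
  have hs : ∀ s : ℝ, 0 < s → ∃ σ : ℝ, s = b ^ σ := fun s h =>
    ⟨Real.logb b s, (Real.rpow_logb hb0 hb.ne' h).symm⟩
  have sq : ∀ x : ℝ, (b ^ x) ^ 2 = b ^ (2 * x) := fun x => by
    rw [← Real.rpow_natCast, ← Real.rpow_mul hb0.le, mul_comm]; norm_num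
  have one : (1 : ℝ) = b ^ (0 : ℝ) := (Real.rpow_zero b).symm
  -- One constant for all ten properties. The term 4a comes from the mean value inequality, where
  -- two squared distances each contribute an error 2a in the exponent.
  refine ⟨b ^ (c₁ + c₂ + c₃ + c₄ + c₅ + c₆ + 4 * a), ⟨?_, ?_, ?_, ?_, ?_, ?_, ?_, ?_, ?_, ?_⟩⟩
  · exact Real.one_le_rpow hb.le (by positivity)
  · intro g η
    have := abs_le.1 (h₁ o g η)
    simp only [boundaryDeriv, expDisp, ← Real.rpow_add hb0]
    exact Real.one_le_rpow hb.le (by linarith)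
  · intro g η
    have := abs_le.1 (h₁ o g η)
    simp only [boundaryDeriv, expDisp, ← Real.rpow_add hb0]
    exact mono (by linarith)
  · intro g h η
    have := abs_le.1 (h₂ o g h η)
    simp only [boundaryDeriv, ← Real.rpow_add hb0]
    exact mono (by linarith)
  · intro g h η
    have := abs_le.1 (h₂ o g h η)
    simp only [boundaryDeriv, ← Real.rpow_add hb0]
    exact mono (by linarith)
  · intro g η ζ
    rcases eq_or_ne η ζ with rfl | hne
    · simp
    obtain ⟨d, hd, hd'⟩ := ha η ζ hne
    obtain ⟨e, he, he'⟩ := ha _ _ ((boundaryMap_injective g).ne hne)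
    have := abs_le.1 (h₃ o g η ζ hne)
    rw [abs_le] at hd' he'
    rw [hd, he]
    simp only [boundaryDeriv, sq, ← Real.rpow_add hb0]
    exact mono (by linarith)
  · intro g η ζ s hs0 hsη hsD
    obtain ⟨σ, rfl⟩ := hs s hs0
    simp only [boundaryDeriv, expDisp, ← Real.rpow_add hb0, iff] at hsη ⊢
    rcases eq_or_ne η ζ with rfl | hne
    · linarith
    obtain ⟨d, hd, hd'⟩ := ha η ζ hne
    rw [hd, sq, ← Real.rpow_add hb0, one, iff] at hsD
    rw [abs_le] at hd'
    rcases min_le_iff.1 (h₄ o g η ζ hne).1 with h | h <;> linarith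
  · intro g η ζ s hs0 hsη hsζ
    obtain ⟨σ, rfl⟩ := hs s hs0
    simp only [boundaryDeriv, expDisp, ← Real.rpow_add hb0, iff] at hsη hsζ
    rcases eq_or_ne η ζ with rfl | hne
    · simp only [dist_self, ne_eq, OfNat.ofNat_ne_zero, not_false_eq_true, zero_pow, mul_zero]
      positivity
    obtain ⟨d, hd, hd'⟩ := ha η ζ hne
    rw [hd, sq, ← Real.rpow_add hb0, iff]
    rw [abs_le] at hd'
    have := (h₄ o g η ζ hne).2
    rcases min_cases (busemann η o (g⁻¹ o)) (busemann ζ o (g⁻¹ o)) with h | h <;> linarith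
  · intro g h η s hs0 hsg hsh
    obtain ⟨σ, rfl⟩ := hs s hs0
    simp only [boundaryDeriv, expDisp, ← Real.rpow_add hb0, iff] at hsg hsh ⊢
    rcases min_le_iff.1 (h₅ o g h η) with h | h <;> linarith
  · intro g η
    simp only [boundaryDeriv, expDisp, ← Real.rpow_add hb0, iff]
    have := h₆ o g η
    linarith

namespace BoundaryGeometry

variable {C : ℝ}

theorem pos (hC : BoundaryGeometry X b o C) : 0 < C := by linarith [hC.one_le]

theorem one_le_deriv_inv (hC : BoundaryGeometry X b o C) (g : X ≃ᵢ X) (η : GromovBoundary X) :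
    1 ≤ C * (boundaryDeriv b o g⁻¹ (boundaryMap g η) * boundaryDeriv b o g η) := by
  have := hC.deriv_mul_le g⁻¹ g η
  rwa [inv_mul_cancel, boundaryDeriv_one] at this

theorem deriv_inv_le (hC : BoundaryGeometry X b o C) (g : X ≃ᵢ X) (η : GromovBoundary X) :
    boundaryDeriv b o g⁻¹ (boundaryMap g η) * boundaryDeriv b o g η ≤ C := by
  have := hC.le_deriv_mul g⁻¹ g η
  rwa [inv_mul_cancel, boundaryDeriv_one, mul_one] at this

theorem dist_map_le (hC : BoundaryGeometry X b o C) (hb : 1 < b) (g : X ≃ᵢ X)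
    (η ζ : GromovBoundary X) :
    dist (boundaryMap g η) (boundaryMap g ζ) ≤ C ^ 2 * expDisp b o g * dist η ζ := by
  have h1 := hC.pos
  have h2 := expDisp_pos (o := o) hb g
  refine le_of_sq_le_sq ?_ (by positivity)
  calc _ ≤ _ := hC.dist_map_sq_le g η ζ
    _ ≤ C * ((C * expDisp b o g) * (C * expDisp b o g) * dist η ζ ^ 2) := by
      have := boundaryDeriv_pos (o := o) hb g ζ
      gcongr <;> exact hC.deriv_le _ _
    _ = 1 * C ^ 3 * (expDisp b o g * dist η ζ) ^ 2 := by ring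
    _ ≤ C * C ^ 3 * (expDisp b o g * dist η ζ) ^ 2 := by
      gcongr; exact hC.one_le
    _ = _ := by ring

theorem continuous_boundaryMap (hC : BoundaryGeometry X b o C) (hb : 1 < b) (g : X ≃ᵢ X) :
    Continuous (boundaryMap g) := by
  have h1 := hC.pos
  have h2 := expDisp_pos (o := o) hb g
  exact (LipschitzWith.of_dist_le_mul (K := ⟨C ^ 2 * expDisp b o g, by positivity⟩)
    fun η ζ => hC.dist_map_le hb g η ζ).continuous

theorem measurable_boundaryMap [MeasurableSpace (GromovBoundary X)]
    [BorelSpace (GromovBoundary X)] (hC : BoundaryGeometry X b o C) (hb : 1 < b) (g : X ≃ᵢ X) :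
    Measurable (boundaryMap g) :=
  (hC.continuous_boundaryMap hb g).measurable

theorem measurableSet_image [MeasurableSpace (GromovBoundary X)]
    [BorelSpace (GromovBoundary X)] (hC : BoundaryGeometry X b o C) (hb : 1 < b) (g : X ≃ᵢ X)
    {A : Set (GromovBoundary X)} (hA : MeasurableSet A) : MeasurableSet (boundaryMap g '' A) := by
  rw [image_boundaryMap]
  exact hC.measurable_boundaryMap hb _ hA

end BoundaryGeometry

end Multiplicative

/-! ### A packing inequality without doubling -/

section Packing

variable {ι Z : Type*}

/-- Two indices in `F` whose sets meet. -/
def Overlap (P : ι → Set Z) (F : Finset ι) (p q : ι) : Prop :=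
  p ∈ F ∧ q ∈ F ∧ (P p ∩ P q).Nonempty

theorem eqvGen_overlap_mono {P : ι → Set Z} {F F' : Finset ι} (h : F ⊆ F') {p q : ι}
    (hpq : Relation.EqvGen (Overlap P F) p q) : Relation.EqvGen (Overlap P F') p q :=
  hpq.mono fun _ _ hab => ⟨h hab.1, h hab.2.1, hab.2.2⟩

theorem eq_of_eqvGen_overlap {P : ι → Set Z} {F : Finset ι} {α : Type*} {f : ι → α}
    (hf : ∀ p ∈ F, ∀ q ∈ F, (P p ∩ P q).Nonempty → f p = f q) {p q : ι}
    (h : Relation.EqvGen (Overlap P F) p q) : f p = f q := by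
  induction h with
  | rel _ _ h => exact hf _ h.1 _ h.2.1 h.2.2
  | refl => rfl
  | symm _ _ _ ih => exact ih.symm
  | trans _ _ _ _ _ ih₁ ih₂ => exact ih₁.trans ih₂

variable [MetricSpace Z]

theorem dist_le_of_inter_nonempty {A B : Set Z} {x y : Z} {r s : ℝ}
    (hA : A ⊆ Metric.closedBall x r) (hB : B ⊆ Metric.closedBall y s)
    (h : (A ∩ B).Nonempty) : dist x y ≤ r + s := by
  obtain ⟨z, hz⟩ := h
  exact (dist_triangle_left x y z).trans (add_le_add (hA hz.1) (hB hz.2))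

/-- In a family of small sets around points that are separated on the scale of the smaller
set, every class of the equivalence relation generated by overlapping is concentrated near its
largest member. -/
theorem exists_overlap_top {x : ι → Z} {e : ι → ℝ} {P : ι → Set Z} {κ : ℝ}
    (hκ0 : 0 ≤ κ) (hκ : κ ≤ 1 / 100) (F : Finset ι) (he : ∀ p ∈ F, 0 < e p)
    (hP : ∀ p ∈ F, P p ⊆ Metric.closedBall (x p) (κ * e p))
    (hsep : ∀ g ∈ F, ∀ h ∈ F, g ≠ h → e h ≤ e g → e h < dist (x g) (x h)) :
    ∃ top : ι → ι, (∀ q ∈ F, top q ∈ F ∧ e q ≤ e (top q) ∧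
        dist (x q) (x (top q)) ≤ 2 * κ * e (top q) ∧
        Relation.EqvGen (Overlap P F) q (top q)) ∧
      ∀ p ∈ F, ∀ q ∈ F, (P p ∩ P q).Nonempty → top p = top q := by
  classical
  induction F using Finset.induction_on_max_value e with
  | empty => exact ⟨id, by simp, by simp⟩
  | insert m F hmF hmax ih =>
    obtain ⟨t, ht, ht'⟩ := ih (fun p hp => he p (Finset.mem_insert_of_mem hp))
      (fun p hp => hP p (Finset.mem_insert_of_mem hp))
      (fun g hg h hh => hsep g (Finset.mem_insert_of_mem hg) h (Finset.mem_insert_of_mem hh))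
    have hsub : F ⊆ insert m F := Finset.subset_insert _ _
    -- The classes that the new, largest index m absorbs: its own, and those with a member whose set
    -- meets P m. Old classes are recognised by their value of t.
    let adj : ι → Prop := fun q => q = m ∨ ∃ v ∈ F, t v = t q ∧ (P v ∩ P m).Nonempty
    have hm : m ∈ insert m F := Finset.mem_insert_self _ _
    refine ⟨fun q => if adj q then m else t q, fun q hq => ?_, fun p hp q hq hpq => ?_⟩
    · by_cases hadj : adj q
      · simp only [hadj, if_true]
        rcases hadj with rfl | ⟨v, hv, hvq, hvm⟩
        · refine ⟨hm, le_rfl, ?_, .refl _⟩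
          have := he q hm
          rw [dist_self]; positivity
        by_cases hqm : q = m
        · subst hqm
          refine ⟨hm, le_rfl, ?_, .refl _⟩
          have := he q hm
          rw [dist_self]; positivity
        have hqF : q ∈ F := (Finset.mem_insert.1 hq).resolve_left hqm
        obtain ⟨h1, h2, h3, h4⟩ := ht q hqF
        obtain ⟨-, h5, h6, h7⟩ := ht v hv
        rw [hvq] at h5 h6 h7
        refine ⟨hm, hmax q hqF, ?_, ?_⟩
        · have h8 := dist_le_of_inter_nonempty (hP v (hsub hv)) (hP m hm) hvm
          have h9 := hsep m hm (t q) (hsub h1) (fun h => hmF (h ▸ h1)) (hmax _ h1)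
          have h10 := dist_triangle4 (x q) (x (t q)) (x v) (x m)
          have h11 := dist_triangle (x (t q)) (x v) (x m)
          rw [dist_comm] at h9
          rw [dist_comm (x v) (x (t q))] at h6
          have hem := he m hm
          have heu := he _ (hsub h1)
          have h12 : κ * e v ≤ κ * e (t q) := by gcongr
          have h13 : κ * e (t q) ≤ 1 / 100 * e (t q) := by gcongr
          have h14 : κ * e m ≤ 1 / 100 * e m := by gcongr
          -- The chain from the old top u = t q through v to m has length at most 3κ e(u) + κ e(m),
          -- whereas separation requires more than e(u). So u is much smaller than m, and the
          -- absorbed class stays within 5κ e(u) + κ e(m) ≤ 2κ e(m) of x(m).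
          have h15 : e (t q) ≤ e m / 50 := by linarith
          have h16 : κ * e (t q) ≤ κ * (e m / 50) := by gcongr
          have h17 : 0 ≤ κ * e m := by positivity
          linarith
        · exact (eqvGen_overlap_mono hsub h4).trans _ _ _
            ((eqvGen_overlap_mono hsub h7).symm.trans _ _ _ (.rel _ _ ⟨hsub hv, hm, hvm⟩))
      · simp only [hadj, if_false]
        have hqF : q ∈ F := (Finset.mem_insert.1 hq).resolve_left fun h => hadj (.inl h)
        obtain ⟨h1, h2, h3, h4⟩ := ht q hqF
        exact ⟨hsub h1, h2, h3, eqvGen_overlap_mono hsub h4⟩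
    · have hiff : adj p ↔ adj q := by
        rcases Finset.mem_insert.1 hp with rfl | hp' <;>
          rcases Finset.mem_insert.1 hq with rfl | hq'
        · rfl
        · exact iff_of_true (.inl rfl) (.inr ⟨q, hq', rfl, inter_comm _ _ ▸ hpq⟩)
        · exact iff_of_true (.inr ⟨p, hp', rfl, hpq⟩) (.inl rfl)
        · have hne : ∀ r ∈ F, r ≠ m := fun r hr h => hmF (h ▸ hr)
          simp only [adj, hne p hp', hne q hq', false_or, ht' p hp' q hq' hpq]
      by_cases hadj : adj q
      · simp only [hiff.2 hadj, hadj, if_true]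
      · have hadj' : ¬ adj p := fun h => hadj (hiff.1 h)
        simp only [hadj, hadj', if_false]
        exact ht' p ((Finset.mem_insert.1 hp).resolve_left fun h => hadj' (.inl h)) q
          ((Finset.mem_insert.1 hq).resolve_left fun h => hadj (.inl h)) hpq

open Relation in
/-- A packing inequality without any doubling assumption: if the part of the family below each
`u` is contained in a small portion of `P u`, then the measures of the sets `E g` have a bounded
sum. -/
theorem sum_measure_le_of_packing [MeasurableSpace Z] {μ : Measure Z}
    [IsFiniteMeasure μ] {x : ι → Z} {e s : ι → ℝ} {P E : ι → Set Z} {κ : ℝ}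
    (hκ0 : 0 ≤ κ) (hκ : κ ≤ 1 / 100) (F : Finset ι)
    (hPm : ∀ g ∈ F, MeasurableSet (P g)) (hEm : ∀ g ∈ F, MeasurableSet (E g))
    (hP : ∀ g ∈ F, P g ⊆ Metric.closedBall (x g) (κ * e g)) (hEP : ∀ g ∈ F, E g ⊆ P g)
    (hE : ∀ g ∈ F, E g ⊆ Metric.closedBall (x g) (κ * s g))
    (hs0 : ∀ g ∈ F, 0 < s g) (hse : ∀ g ∈ F, s g ≤ e g)
    (hmono : ∀ g ∈ F, ∀ h ∈ F, e h ≤ e g → s h ≤ s g)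
    (hsep : ∀ g ∈ F, ∀ h ∈ F, g ≠ h → e h ≤ e g → e h < dist (x g) (x h))
    (hsmall : ∀ u ∈ F, μ (⋃ h ∈ {h | h ∈ F ∧ e h ≤ e u ∧ dist (x h) (x u) ≤ 2 * κ * e u},
      Metric.closedBall (x h) (7 * κ * s h)) ≤ μ (P u) / 2) :
    ∑ g ∈ F, μ (E g) ≤ 2 * μ univ := by
  classical
  have he : ∀ g ∈ F, 0 < e g := fun g hg => (hs0 g hg).trans_le (hse g hg)
  -- Each index has a large scale e, for P, and a small scale s, for E. Relative to g, only the
  -- indices whose large scale is below s g will matter.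
  let Fs : ι → Finset ι := fun g => F.filter fun q => e q ≤ s g
  have hFs : ∀ {g q}, q ∈ Fs g ↔ q ∈ F ∧ e q ≤ s g := Finset.mem_filter
  have htop : ∀ g, ∃ top : ι → ι, (∀ q ∈ Fs g, top q ∈ Fs g ∧ e q ≤ e (top q) ∧
        dist (x q) (x (top q)) ≤ 2 * κ * e (top q) ∧
        EqvGen (Overlap P (Fs g)) q (top q)) ∧
      ∀ p ∈ Fs g, ∀ q ∈ Fs g, (P p ∩ P q).Nonempty → top p = top q := fun g =>
    exists_overlap_top hκ0 hκ (Fs g) (fun p hp => he p (hFs.1 hp).1)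
      (fun p hp => hP p (hFs.1 hp).1)
      (fun p hp q hq => hsep p (hFs.1 hp).1 q (hFs.1 hq).1)
  choose top htop htop' using htop
  let A : ι → ι → Prop := fun g q => q ∈ Fs g ∧ ∃ v ∈ Fs g, EqvGen (Overlap P (Fs g)) q v ∧
    (P v ∩ E g).Nonempty
  -- W g is E g saturated by all small pieces linked to it through overlaps. Saturation ensures that
  -- a smaller W h meeting W g has its whole piece P h inside W g.
  let W : ι → Set Z := fun g => E g ∪ ⋃ q ∈ {q | A g q}, P q
  have hPW : ∀ {g q}, A g q → P q ⊆ W g := fun {g q} h =>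
    (subset_biUnion_of_mem (u := P) (show q ∈ {q | A g q} from h)).trans subset_union_right
  have hAfin : ∀ g, {q | A g q}.Finite := fun g => (Fs g).finite_toSet.subset fun q hq => hq.1
  have hWm : ∀ g ∈ F, MeasurableSet (W g) := fun g hg =>
    (hEm g hg).union ((hAfin g).measurableSet_biUnion fun q hq => hPm q (hFs.1 hq.1).1)
  -- The factor 7 is 1 + 2 + 2 + 1 + 1: from y to x q, from there to the common top of q and v, from
  -- the top to x v, and two radii from x v to x g.
  have hWball : ∀ g ∈ F, W g ⊆ Metric.closedBall (x g) (7 * κ * s g) := by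
    rintro g hg y (hy | hy)
    · have h1 : dist y (x g) ≤ κ * s g := hE g hg hy
      have h2 : 0 ≤ κ * s g := mul_nonneg hκ0 (hs0 g hg).le
      rw [Metric.mem_closedBall]; linarith
    · simp only [mem_iUnion] at hy
      obtain ⟨q, ⟨hq, v, hv, hqv, hvE⟩, hy⟩ := hy
      have h1 := eq_of_eqvGen_overlap (htop' g) hqv
      obtain ⟨-, -, h2, -⟩ := htop g q hq
      obtain ⟨h3, -, h4, -⟩ := htop g v hv
      have h5 : dist y (x q) ≤ κ * e q := hP q (hFs.1 hq).1 hy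
      have h6 := dist_le_of_inter_nonempty (hP v (hFs.1 hv).1) (hE g hg) hvE
      rw [h1] at h2
      rw [dist_comm] at h4
      have h7 : κ * e q ≤ κ * s g := by gcongr; exact (hFs.1 hq).2
      have h8 : κ * e v ≤ κ * s g := by gcongr; exact (hFs.1 hv).2
      have h9 : κ * e (top g v) ≤ κ * s g := by gcongr; exact (hFs.1 h3).2
      have h10 := dist_triangle4 y (x q) (x (top g v)) (x v)
      have h11 := dist_triangle y (x v) (x g)
      rw [Metric.mem_closedBall]; linarith
  have hmeet : ∀ g ∈ F, ∀ h ∈ F, g ≠ h → e h ≤ e g → (W h ∩ W g).Nonempty → A g h := by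
    intro g hg h hh hne heh hW
    by_cases hs : e h ≤ s g
    swap
    -- If e h > s g, both saturations have radius at most 7/100 of e h, and meeting would contradict
    -- separation.
    · exfalso
      have h1 := dist_le_of_inter_nonempty (hWball h hh) (hWball g hg) hW
      have h2 := hsep g hg h hh hne heh
      rw [dist_comm] at h2
      have h3 : κ * s h ≤ 1 / 100 * e h := mul_le_mul hκ (hse h hh) (hs0 h hh).le (by norm_num)
      have h4 : κ * s g ≤ 1 / 100 * e h :=
        mul_le_mul hκ (not_le.1 hs).le (hs0 g hg).le (by norm_num)
      linarith [he h hh]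
    have hhg : h ∈ Fs g := hFs.2 ⟨hh, hs⟩
    have hsub : Fs h ⊆ Fs g := fun q hq =>
      hFs.2 ⟨(hFs.1 hq).1, (hFs.1 hq).2.trans (hmono g hg h hh heh)⟩
    obtain ⟨y, hyh, hyg⟩ := hW
    obtain ⟨q, hq, hhq, hyq⟩ : ∃ q ∈ Fs g, EqvGen (Overlap P (Fs g)) h q ∧ y ∈ P q := by
      rcases hyh with hy | hy
      · exact ⟨h, hhg, .refl _, hEP h hh hy⟩
      · simp only [mem_iUnion] at hy
        obtain ⟨q, ⟨hq, v, hv, hqv, w, hw⟩, hy⟩ := hy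
        refine ⟨q, hsub hq, ?_, hy⟩
        exact .trans _ _ _ (.rel _ _ ⟨hhg, hsub hv, w, hEP h hh hw.2, hw.1⟩)
          (eqvGen_overlap_mono hsub hqv).symm
    rcases hyg with hy | hy
    · exact ⟨hhg, q, hq, hhq, y, hyq, hy⟩
    · simp only [mem_iUnion] at hy
      obtain ⟨q', ⟨hq', v, hv, hqv, hvE⟩, hy⟩ := hy
      exact ⟨hhg, v, hv, hhq.trans _ _ _ (.trans _ _ _ (.rel _ _ ⟨hq, hq', y, hyq, hy⟩) hqv), hvE⟩
  have hbelow : ∀ g ∈ F, μ (⋃ h ∈ {h | A g h}, W h) ≤ μ (W g) / 2 := by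
    intro g hg
    -- One top for each class below g. The pieces of different tops are disjoint and lie in W g, and
    -- `hsmall` at a top bounds everything in its class by half of its piece.
    let T : Finset ι := (hAfin g).toFinset.image (top g)
    have hT : ∀ u ∈ T, ∃ q, A g q ∧ top g q = u := fun u hu => by
      obtain ⟨q, hq, rfl⟩ := Finset.mem_image.1 hu
      exact ⟨q, (hAfin g).mem_toFinset.1 hq, rfl⟩
    have hTtop : ∀ u ∈ T, top g u = u := fun u hu => by
      obtain ⟨q, hq, rfl⟩ := hT u hu
      exact (eq_of_eqvGen_overlap (htop' g) (htop g q hq.1).2.2.2).symm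
    have hTF : ∀ u ∈ T, u ∈ Fs g := fun u hu => by
      obtain ⟨q, hq, rfl⟩ := hT u hu
      exact (htop g q hq.1).1
    have hTA : ∀ u ∈ T, A g u := fun u hu => by
      obtain ⟨q, ⟨hq, v, hv, hqv, hvE⟩, rfl⟩ := hT u hu
      exact ⟨hTF _ hu, v, hv, .trans _ _ _ (htop g q hq).2.2.2.symm hqv, hvE⟩
    calc μ (⋃ h ∈ {h | A g h}, W h)
        ≤ μ (⋃ u ∈ T, ⋃ h ∈ {h | h ∈ F ∧ e h ≤ e u ∧ dist (x h) (x u) ≤ 2 * κ * e u},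
            Metric.closedBall (x h) (7 * κ * s h)) := by
          refine measure_mono (iUnion₂_subset fun h hh => ?_)
          obtain ⟨-, h2, h3, -⟩ := htop g h hh.1
          have hu : top g h ∈ T := Finset.mem_image_of_mem _ ((hAfin g).mem_toFinset.2 hh)
          refine Subset.trans ?_ (subset_biUnion_of_mem hu)
          have hhF := (hFs.1 hh.1).1
          exact (hWball h hhF).trans (subset_biUnion_of_mem
            (u := fun h => Metric.closedBall (x h) (7 * κ * s h)) ⟨hhF, h2, h3⟩)
      _ ≤ ∑ u ∈ T, μ (P u) / 2 := (measure_biUnion_finset_le _ _).trans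
          (Finset.sum_le_sum fun u hu => hsmall u (hFs.1 (hTF u hu)).1)
      _ = (∑ u ∈ T, μ (P u)) / 2 := by simp only [div_eq_mul_inv, Finset.sum_mul]
      _ = μ (⋃ u ∈ T, P u) / 2 := by
          rw [measure_biUnion_finset _ fun u hu => hPm u (hFs.1 (hTF u hu)).1]
          intro u hu v hv huv
          refine Set.disjoint_iff_inter_eq_empty.2 (not_nonempty_iff_eq_empty.1 fun h => huv ?_)
          rw [← hTtop u hu, ← hTtop v hv]
          exact htop' g u (hTF u hu) v (hTF v hv) h
      _ ≤ μ (W g) / 2 := by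
          gcongr
          exact iUnion₂_subset fun u hu => hPW (hTA u hu)
  -- Removing the saturations of no larger scale keeps at least half of the measure of W g, and
  -- makes the sets disjoint.
  let D : ι → Set Z := fun g => W g \ ⋃ h ∈ {h | h ∈ F ∧ g ≠ h ∧ e h ≤ e g}, W h
  have hDm : ∀ g ∈ F, MeasurableSet (D g) := fun g hg => (hWm g hg).diff
    ((F.finite_toSet.subset fun q hq => hq.1).measurableSet_biUnion fun q hq => hWm q hq.1)
  have hWD : ∀ g ∈ F, μ (W g) ≤ 2 * μ (D g) := by
    intro g hg
    have h1 : W g ⊆ D g ∪ ⋃ h ∈ {h | A g h}, W h := by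
      intro y hy
      by_cases hyD : y ∈ D g
      · exact .inl hyD
      · have : y ∈ ⋃ h ∈ {h | h ∈ F ∧ g ≠ h ∧ e h ≤ e g}, W h := by
          by_contra h
          exact hyD ⟨hy, h⟩
        simp only [mem_iUnion] at this
        obtain ⟨h, ⟨hh, hne, heh⟩, hyh⟩ := this
        exact .inr (mem_biUnion (show h ∈ {h | A g h} from
          hmeet g hg h hh hne heh ⟨y, hyh, hy⟩) hyh)
    have h2 : μ (W g) ≤ μ (D g) + μ (W g) / 2 :=
      (measure_mono h1).trans ((measure_union_le _ _).trans (by gcongr; exact hbelow g hg))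
    have h3 : μ (W g) / 2 ≠ ∞ := ENNReal.div_ne_top (measure_ne_top _ _) (by norm_num)
    have h4 : μ (W g) / 2 ≤ μ (D g) := by
      rw [← ENNReal.add_le_add_iff_right h3, ENNReal.add_halves]
      exact h2
    rw [mul_comm]
    exact (ENNReal.div_le_iff (by norm_num) (by norm_num)).1 h4
  calc ∑ g ∈ F, μ (E g) ≤ ∑ g ∈ F, 2 * μ (D g) := Finset.sum_le_sum fun g hg =>
        (measure_mono subset_union_left).trans (hWD g hg)
    _ = 2 * μ (⋃ g ∈ F, D g) := by
        rw [← Finset.mul_sum, measure_biUnion_finset _ hDm]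
        intro g hg h hh hne
        refine Set.disjoint_left.2 fun y hyg hyh => ?_
        rcases le_total (e h) (e g) with hle | hle
        · exact hyg.2 (mem_biUnion (show h ∈ {h | h ∈ F ∧ g ≠ h ∧ e h ≤ e g} from
            ⟨hh, hne, hle⟩) hyh.1)
        · exact hyh.2 (mem_biUnion (show g ∈ {g | g ∈ F ∧ h ≠ g ∧ e g ≤ e h} from
            ⟨hg, hne.symm, hle⟩) hyg.1)
    _ ≤ 2 * μ univ := by gcongr; exact subset_univ _

end Packing

/-! ### Convergence cases: Borel–Cantelli and bounded parabolic points -/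

section Convergence

theorem mul_le_of_antitoneOn_mul {Φ : ℝ → ℝ} (hΦ : ∀ t, 0 < t → 0 < Φ t)
    (hΦ' : AntitoneOn (fun t => t * Φ t) (Ioi 0)) {c t t' : ℝ} (hc : 1 ≤ c) (ht : 0 < t)
    (h : c * t ≤ t') : c * Φ t' ≤ Φ t := by
  have htt : t ≤ t' := le_trans (by nlinarith) h
  have ht' : 0 < t' := ht.trans_le htt
  have h1 : t' * Φ t' ≤ t * Φ t := hΦ' ht ht' htt
  have h2 : c * t * Φ t' ≤ t' * Φ t' := mul_le_mul_of_nonneg_right h (hΦ t' ht').le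
  refine le_of_mul_le_mul_left ?_ ht
  linarith

/-- The complement of the closure of S is open and contains ξ, hence contains some N_t(ξ). -/
theorem IsPointBounded.exists_mixedProduct_le {X : Type*} [MetricSpace X]
    [GromovHyperbolic X] {o : X} {ξ : GromovBoundary X}
    {S : Set (GromovClosure X)} (h : IsPointBounded o ξ S) :
    ∃ t : ℝ≥0, ∀ y : X, GromovClosure.inner y ∈ S → mixedProduct y ξ o ≤ t := by
  let _ := gromovClosureTopology (X := X) o
  have hopen : IsOpen (closure S)ᶜ := isClosed_closure.isOpen_compl
  obtain ⟨t, ht⟩ := hopen.2 ξ h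
  refine ⟨t, fun y hy => ?_⟩
  by_contra! hlt
  exact ht (show GromovClosure.inner y ∈ {y | (t : ℝ≥0∞) < closureProduct y ξ o} from hlt)
    (subset_closure hy)

variable {X : Type*} [MetricSpace X] [GromovHyperbolic X] [MetricSpace (GromovBoundary X)]
  {b : ℝ} {o : X} {C : ℝ} {G : Subgroup (X ≃ᵢ X)}

/-- On a ball around `g ξ` that is small on the scale of `g`, the derivative of the inverse of
`g` is almost constant. -/
theorem BoundaryGeometry.preimage_ball (hC : BoundaryGeometry X b o C) (hb : 1 < b)
    (g : X ≃ᵢ X) (ξ η : GromovBoundary X)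
    (hη : C * dist (boundaryMap g ξ) η * expDisp b o g ≤ 1) :
    boundaryDeriv b o g (boundaryMap g⁻¹ η) ≤ C ^ 3 * boundaryDeriv b o g ξ ∧
      dist (boundaryMap g⁻¹ η) ξ * boundaryDeriv b o g ξ ≤
        C ^ 2 * dist (boundaryMap g ξ) η := by
  have hC0 := hC.pos
  have hC1 := hC.one_le
  set r := dist (boundaryMap g ξ) η with hr
  have hr0 : 0 ≤ r := dist_nonneg
  set l := expDisp b o g with hl
  have hl0 : 0 < l := expDisp_pos hb g
  set a := boundaryDeriv b o g ξ
  set v := boundaryDeriv b o g⁻¹ (boundaryMap g ξ)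
  set w := boundaryDeriv b o g⁻¹ η
  set z := boundaryDeriv b o g (boundaryMap g⁻¹ η)
  have ha : 0 < a := boundaryDeriv_pos hb _ _
  have hv : 0 < v := boundaryDeriv_pos hb _ _
  have hw : 0 < w := boundaryDeriv_pos hb _ _
  have hz : 0 < z := boundaryDeriv_pos hb _ _
  have hva : 1 ≤ C * (v * a) := hC.one_le_deriv_inv g ξ
  have hva' : v * a ≤ C := hC.deriv_inv_le g ξ
  have hwz' : w * z ≤ C := by
    have := hC.deriv_inv_le g (boundaryMap g⁻¹ η)
    rwa [boundaryMap_apply_inv] at this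
  have hvl : v ≤ C * l := by
    have := hC.deriv_le g⁻¹ (boundaryMap g ξ)
    rwa [expDisp_inv] at this
  have hwl : w ≤ C * l := by
    have := hC.deriv_le g⁻¹ η
    rwa [expDisp_inv] at this
  -- As (g⁻¹)' ≤ C l, this makes `near` applicable to g⁻¹ between gξ and η in both directions, so
  -- its derivatives there are comparable.
  have hsmall : C * l * l * r ^ 2 ≤ 1 := by
    have h1 : (C * r * l) ^ 2 ≤ 1 := pow_le_one₀ (by positivity) hη
    have h2 : C * (l * l * r ^ 2) ≤ C * (C * (l * l * r ^ 2)) :=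
      mul_le_mul_of_nonneg_left (le_mul_of_one_le_left (by positivity) hC1) hC0.le
    linarith
  have hvw : v ≤ C * w := by
    have := hC.near g⁻¹ (boundaryMap g ξ) η (v * expDisp b o g⁻¹)
      (by rw [expDisp_inv]; positivity) le_rfl
      (by rw [expDisp_inv]
          refine le_trans ?_ hsmall
          gcongr)
    rw [expDisp_inv, ← mul_assoc] at this
    exact le_of_mul_le_mul_right this hl0
  have hwv : w ≤ C * v := by
    have := hC.near g⁻¹ η (boundaryMap g ξ) (w * expDisp b o g⁻¹)
      (by rw [expDisp_inv]; positivity) le_rfl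
      (by rw [expDisp_inv, dist_comm]
          refine le_trans ?_ hsmall
          gcongr)
    rw [expDisp_inv, ← mul_assoc] at this
    exact le_of_mul_le_mul_right this hl0
  constructor
  · calc z ≤ C * (v * a) * z := le_mul_of_one_le_left hz.le hva
      _ ≤ C * (C * w * a) * z := by gcongr
      _ = C ^ 2 * a * (w * z) := by ring
      _ ≤ C ^ 2 * a * C := by gcongr
      _ = C ^ 3 * a := by ring
  · have h1 := hC.dist_map_sq_le g⁻¹ η (boundaryMap g ξ)
    rw [boundaryMap_inv_apply] at h1
    refine le_of_sq_le_sq ?_ (by positivity)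
    calc (dist (boundaryMap g⁻¹ η) ξ * a) ^ 2
        = dist (boundaryMap g⁻¹ η) ξ ^ 2 * a ^ 2 := by ring
      _ ≤ C * (w * v * dist η (boundaryMap g ξ) ^ 2) * a ^ 2 := by gcongr
      _ = C * (w * v * r ^ 2) * a ^ 2 := by rw [dist_comm η]
      _ ≤ C * (C * v * v * r ^ 2) * a ^ 2 := by gcongr
      _ = C ^ 2 * (v * a) ^ 2 * r ^ 2 := by ring
      _ ≤ C ^ 2 * C ^ 2 * r ^ 2 := by gcongr
      _ = (C ^ 2 * r) ^ 2 := by ring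

variable [MeasurableSpace (GromovBoundary X)] [BorelSpace (GromovBoundary X)]

/-- The convergence case, for a subset `T` of the group. -/
theorem measure_wellApproximable_eq_zero_of_subset (hb : 1 < b) (hvis : IsVisualMetric X b o)
    (hG : StronglyDiscrete o G) {ξ : GromovBoundary X} {δ : ℝ} (hδ : 0 ≤ δ)
    {μ : Measure (GromovBoundary X)} (hqc : IsQuasiconformal b o G δ μ) (hμξ : μ {ξ} = 0)
    {Φ : ℝ → ℝ} (hΦ : ∀ t, 0 < t → 0 < Φ t) (hΦ' : AntitoneOn (fun t => t * Φ t) (Ioi 0))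
    {T : Set (X ≃ᵢ X)} (hT : T ⊆ G) {K : ℝ} (hK : 0 < K)
    (hsum : ∑' g : T, ENNReal.ofReal (boundaryDeriv b o (g : X ≃ᵢ X) ξ ^ δ) *
      μ (Metric.closedBall ξ (Φ (K * expDisp b o (g : X ≃ᵢ X)) /
        boundaryDeriv b o (g : X ≃ᵢ X) ξ)) < ∞) :
    μ {η | ∀ K : ℝ, 0 < K → ∃ g ∈ T, dist (boundaryMap g ξ) η ≤ Φ (K * expDisp b o g)} = 0 := by
  obtain ⟨C, hC⟩ := exists_boundaryGeometry hb hvis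
  obtain ⟨Q, hQ⟩ := hqc.exists_bounds hb hδ
  have hC0 := hC.pos
  have hC1 := hC.one_le
  have : Countable G := hG.countable
  have : Countable T := (Set.Countable.mono hT (Set.countable_coe_iff.1 this)).to_subtype
  have hl : ∀ g : X ≃ᵢ X, 0 < expDisp b o g := fun g => expDisp_pos hb g
  have hl1 : ∀ g : X ≃ᵢ X, 1 ≤ expDisp b o g := fun g => one_le_expDisp hb g
  have hatom : ∀ g ∈ G, μ {boundaryMap g ξ} = 0 := fun g hg => by
    have h := (hQ g hg {ξ} (measurableSet_singleton ξ) (boundaryDeriv b o g ξ)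
      (boundaryDeriv_pos hb g ξ).le).1 (by rintro η rfl; exact le_rfl)
    rw [hμξ, mul_zero, image_singleton] at h
    exact le_antisymm h bot_le
  have hΦ1 : 0 < Φ 1 := hΦ 1 one_pos
  have hdecay : ∀ t, 1 ≤ t → t * Φ t ≤ Φ 1 := fun t ht =>
    mul_le_of_antitoneOn_mul hΦ hΦ' ht one_pos (by linarith)
  -- CΦ(1) makes the balls small enough for `preimage_ball`; C²K absorbs the factor C² by which the
  -- pulled-back radius grows.
  obtain ⟨K', hK'⟩ : ∃ K', K' = max 1 (max (C * Φ 1) (C ^ 2 * K)) := ⟨_, rfl⟩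
  have hK1 : 1 ≤ K' := hK' ▸ le_max_left _ _
  have hK2 : C * Φ 1 ≤ K' := hK' ▸ (le_max_left _ _).trans (le_max_right _ _)
  have hK3 : C ^ 2 * K ≤ K' := hK' ▸ (le_max_right _ _).trans (le_max_right _ _)
  let s : T → Set (GromovBoundary X) := fun g =>
    Metric.closedBall (boundaryMap (g : X ≃ᵢ X) ξ) (Φ (K' * expDisp b o (g : X ≃ᵢ X)))
  have hs : ∀ g : T, μ (s g) ≤ Q * ENNReal.ofReal ((C ^ 3) ^ δ) *
      (ENNReal.ofReal (boundaryDeriv b o (g : X ≃ᵢ X) ξ ^ δ) *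
      μ (Metric.closedBall ξ (Φ (K * expDisp b o (g : X ≃ᵢ X)) /
        boundaryDeriv b o (g : X ≃ᵢ X) ξ))) := by
    rintro ⟨g, hg⟩
    have ha : 0 < boundaryDeriv b o g ξ := boundaryDeriv_pos hb _ _
    have hball : ∀ η ∈ s ⟨g, hg⟩, C * dist (boundaryMap g ξ) η * expDisp b o g ≤ 1 := by
      intro η hη
      have h1 : dist (boundaryMap g ξ) η ≤ Φ (K' * expDisp b o g) := by
        rw [dist_comm]; exact hη
      have h2 := hdecay (K' * expDisp b o g) (one_le_mul_of_one_le_of_one_le hK1 (hl1 g))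
      have h3 : K' * (C * dist (boundaryMap g ξ) η * expDisp b o g) ≤ K' * 1 := by
        calc K' * (C * dist (boundaryMap g ξ) η * expDisp b o g)
            = C * (K' * expDisp b o g * dist (boundaryMap g ξ) η) := by ring
          _ ≤ C * (K' * expDisp b o g * Φ (K' * expDisp b o g)) := by
            have := hl g
            gcongr
          _ ≤ C * Φ 1 := by gcongr
          _ ≤ K' * 1 := by linarith
      exact le_of_mul_le_mul_left h3 (by linarith)
    have himg : boundaryMap g '' (boundaryMap g⁻¹ '' s ⟨g, hg⟩) = s ⟨g, hg⟩ := by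
      rw [← image_comp]
      convert image_id _
      funext η
      exact boundaryMap_apply_inv g η
    have hsub : boundaryMap g⁻¹ '' s ⟨g, hg⟩ ⊆
        Metric.closedBall ξ (Φ (K * expDisp b o g) / boundaryDeriv b o g ξ) := by
      rintro _ ⟨η, hη, rfl⟩
      rw [Metric.mem_closedBall, le_div_iff₀ ha]
      refine (hC.preimage_ball hb g ξ η (hball η hη)).2.trans ?_
      refine le_trans (mul_le_mul_of_nonneg_left (b := dist (boundaryMap g ξ) η)
        (c := Φ (K' * expDisp b o g)) (by rw [dist_comm]; exact hη) (by positivity)) ?_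
      refine mul_le_of_antitoneOn_mul hΦ hΦ' (one_le_pow₀ hC1) (mul_pos hK (hl g)) ?_
      rw [← mul_assoc]
      exact mul_le_mul_of_nonneg_right hK3 (hl g).le
    have h1 := (hQ g (hT hg) (boundaryMap g⁻¹ '' s ⟨g, hg⟩)
      (hC.measurableSet_image hb _ measurableSet_closedBall) (C ^ 3 * boundaryDeriv b o g ξ)
      (by positivity)).1 (by
        rintro _ ⟨η, hη, rfl⟩
        exact (hC.preimage_ball hb g ξ η (hball η hη)).1)
    rw [himg, Real.mul_rpow (by positivity) ha.le, ENNReal.ofReal_mul (by positivity)] at h1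
    calc μ (s ⟨g, hg⟩) ≤ _ := h1
      _ ≤ _ := by
        simp only [← mul_assoc]
        gcongr
  have hBC : μ (limsup s cofinite) = 0 := by
    refine measure_limsup_cofinite_eq_zero (ne_top_of_le_ne_top ?_ (ENNReal.tsum_le_tsum hs))
    rw [ENNReal.tsum_mul_left]
    exact ENNReal.mul_ne_top (ENNReal.mul_ne_top ENNReal.coe_ne_top ENNReal.ofReal_ne_top) hsum.ne
  have horb : μ (⋃ g : T, {boundaryMap (g : X ≃ᵢ X) ξ}) = 0 :=
    measure_iUnion_null fun g => hatom g (hT g.2)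
  refine measure_mono_null ?_ (measure_union_null hBC horb)
  intro η hη
  by_contra hcon
  rw [mem_union, not_or, mem_limsup_iff_frequently_mem, not_frequently, eventually_cofinite] at hcon
  obtain ⟨hfin, hne⟩ := hcon
  simp only [mem_iUnion, mem_singleton_iff, not_exists] at hne
  -- Only finitely many balls contain η, all with centre different from η. For K'' > M the bound
  -- Φ(K''l) ≤ Φ(1)/K'' excludes η from each of them.
  obtain ⟨M, hM⟩ : ∃ M : ℝ, ∀ g ∈ {g : T | ¬ η ∉ s g},
      Φ 1 / dist (boundaryMap (g : X ≃ᵢ X) ξ) η ≤ M := by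
    obtain ⟨M, hM⟩ := (hfin.image fun g : T =>
      Φ 1 / dist (boundaryMap (g : X ≃ᵢ X) ξ) η).bddAbove
    exact ⟨M, fun g hg => hM (mem_image_of_mem _ hg)⟩
  obtain ⟨K'', hK''⟩ : ∃ K'', K'' = max K' (M + 1) := ⟨_, rfl⟩
  have hKK : K' ≤ K'' := hK'' ▸ le_max_left _ _
  have hKM : M + 1 ≤ K'' := hK'' ▸ le_max_right _ _
  obtain ⟨g, hg, hgη⟩ := hη K'' (by linarith)
  have hd : 0 < dist (boundaryMap g ξ) η := dist_pos.2 fun h => hne ⟨g, hg⟩ h.symm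
  have h1 : Φ (K'' * expDisp b o g) ≤ Φ (K' * expDisp b o g) := by
    have := mul_le_of_antitoneOn_mul hΦ hΦ' le_rfl (t := K' * expDisp b o g)
      (t' := K'' * expDisp b o g) (mul_pos (by linarith) (hl g))
      (by rw [one_mul]; exact mul_le_mul_of_nonneg_right hKK (hl g).le)
    linarith
  have h2 : η ∈ s ⟨g, hg⟩ := by
    rw [Metric.mem_closedBall, dist_comm]; exact hgη.trans h1
  have h3 := hM ⟨g, hg⟩ (not_not.2 h2)
  rw [div_le_iff₀ hd] at h3
  have h4 := hdecay (K'' * expDisp b o g)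
    (one_le_mul_of_one_le_of_one_le (hK1.trans hKK) (hl1 g))
  have h5 : K'' * dist (boundaryMap g ξ) η ≤ K'' * expDisp b o g * Φ (K'' * expDisp b o g) := by
    refine mul_le_mul ?_ hgη hd.le (mul_nonneg (by linarith) (hl g).le)
    exact le_mul_of_one_le_right (by linarith) (hl1 g)
  have h6 : (M + 1) * dist (boundaryMap g ξ) η ≤ K'' * dist (boundaryMap g ξ) η := by gcongr
  linarith

theorem measure_wellApproximable_eq_zero_of_derivSeries (hb : 1 < b) (hvis : IsVisualMetric X b o)
    (hG : StronglyDiscrete o G) {ξ : GromovBoundary X} {δ : ℝ} (hδ : 0 ≤ δ)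
    {μ : Measure (GromovBoundary X)} (hqc : IsQuasiconformal b o G δ μ) (hμξ : μ {ξ} = 0)
    {Φ : ℝ → ℝ} (hΦ : ∀ t, 0 < t → 0 < Φ t) (hΦ' : AntitoneOn (fun t => t * Φ t) (Ioi 0))
    {K : ℝ} (hK : 0 < K) (hsum : khinchinDerivSeries b o G δ μ ξ Φ K < ∞) :
    μ (wellApproximable b o G ξ Φ) = 0 :=
  measure_mono_null (fun _ hη => hη.2)
    (measure_wellApproximable_eq_zero_of_subset hb hvis hG hδ hqc hμξ hΦ hΦ' Subset.rfl hK hsum)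

theorem measure_wellApproximable_eq_zero_of_boundedParabolic (hb : 1 < b)
    (hvis : IsVisualMetric X b o)
    (hG : StronglyDiscrete o G) {ξ : GromovBoundary X} {δ : ℝ} (hδ : 0 ≤ δ)
    {μ : Measure (GromovBoundary X)} (hqc : IsQuasiconformal b o G δ μ) (hμξ : μ {ξ} = 0)
    {Φ : ℝ → ℝ} (hΦ : ∀ t, 0 < t → 0 < Φ t) (hΦ' : AntitoneOn (fun t => t * Φ t) (Ioi 0))
    (hpar : IsBoundedParabolicPoint b o G ξ)
    {K : ℝ} (hK : 0 < K) (hsum : khinchinSeries b o G δ μ ξ Φ K < ∞) :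
    μ (wellApproximable b o G ξ Φ) = 0 := by
  obtain ⟨C, hC⟩ := exists_boundaryGeometry hb hvis
  have hC0 := hC.pos
  have hC1 := hC.one_le
  have hl : ∀ g : X ≃ᵢ X, 0 < expDisp b o g := fun g => expDisp_pos hb g
  obtain ⟨-, ⟨-, A, hA0, hA⟩, S, hS, hcover⟩ := hpar
  obtain ⟨t, ht⟩ := hS.exists_mixedProduct_le
  have hb0 : 0 < b := by linarith
  obtain ⟨M, hM⟩ : ∃ M, M = C * b ^ (2 * (t : ℝ)) := ⟨_, rfl⟩
  have hM0 : 0 < M := by rw [hM]; positivity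
  -- Coarsely, the k with ⟨k⁻¹o|ξ⟩_o bounded. There k'(ξ) ≍ 1/l_k, so the terms of (C) are
  -- controlled by those of (D).
  let T : Set (X ≃ᵢ X) := {k | k ∈ G ∧ boundaryDeriv b o k ξ * expDisp b o k ≤ M}
  have hTG : T ⊆ G := fun k hk => hk.1
  have hsumT : ∑' g : T, ENNReal.ofReal (boundaryDeriv b o (g : X ≃ᵢ X) ξ ^ δ) *
      μ (Metric.closedBall ξ (Φ (C * K * expDisp b o (g : X ≃ᵢ X)) /
        boundaryDeriv b o (g : X ≃ᵢ X) ξ)) < ∞ := by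
    have hterm : ∀ g : T, ENNReal.ofReal (boundaryDeriv b o (g : X ≃ᵢ X) ξ ^ δ) *
        μ (Metric.closedBall ξ (Φ (C * K * expDisp b o (g : X ≃ᵢ X)) /
          boundaryDeriv b o (g : X ≃ᵢ X) ξ)) ≤ ENNReal.ofReal (M ^ δ) *
        (ENNReal.ofReal (b ^ (-δ * dist o ((g : X ≃ᵢ X) o))) * μ (Metric.closedBall ξ
          (b ^ dist o ((g : X ≃ᵢ X) o) * Φ (K * b ^ dist o ((g : X ≃ᵢ X) o))))) := by
      rintro ⟨g, hg⟩
      have ha : 0 < boundaryDeriv b o g ξ := boundaryDeriv_pos hb _ _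
      rw [← mul_assoc, ← ENNReal.ofReal_mul (by positivity)]
      refine mul_le_mul' (ENNReal.ofReal_le_ofReal ?_) (measure_mono
        (Metric.closedBall_subset_closedBall ?_))
      · rw [neg_mul, mul_comm δ, ← mul_neg, Real.rpow_mul hb0.le, Real.rpow_neg (by positivity),
          ← Real.inv_rpow (by positivity), ← Real.mul_rpow hM0.le (by positivity)]
        refine Real.rpow_le_rpow ha.le ?_ hδ
        rw [← div_eq_mul_inv, le_div_iff₀ (by positivity)]
        exact hg.2
      · change Φ (C * K * expDisp b o g) / _ ≤ expDisp b o g * Φ (K * expDisp b o g)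
        rw [div_le_iff₀ ha]
        have h1 : C * Φ (C * K * expDisp b o g) ≤ Φ (K * expDisp b o g) :=
          mul_le_of_antitoneOn_mul hΦ hΦ' hC1 (mul_pos hK (hl g)) (by rw [mul_assoc])
        have h2 := hC.one_le_deriv_mul g ξ
        have h3 : 0 < Φ (C * K * expDisp b o g) := hΦ _ (mul_pos (mul_pos hC0 hK) (hl g))
        calc Φ (C * K * expDisp b o g)
            ≤ C * (boundaryDeriv b o g ξ * expDisp b o g) * Φ (C * K * expDisp b o g) :=
              le_mul_of_one_le_left h3.le h2
          _ = expDisp b o g * (C * Φ (C * K * expDisp b o g)) * boundaryDeriv b o g ξ := by ring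
          _ ≤ expDisp b o g * Φ (K * expDisp b o g) * boundaryDeriv b o g ξ := by
            have := hl g
            gcongr
    refine (ENNReal.tsum_le_tsum hterm).trans_lt ?_
    rw [ENNReal.tsum_mul_left]
    refine ENNReal.mul_lt_top ENNReal.ofReal_lt_top (lt_of_le_of_lt ?_ hsum)
    exact ENNReal.tsum_comp_le_tsum_of_injective (f := inclusion hTG) (inclusion_injective hTG)
      (fun g : G => ENNReal.ofReal (b ^ (-δ * dist o ((g : X ≃ᵢ X) o))) * μ (Metric.closedBall ξ
          (b ^ dist o ((g : X ≃ᵢ X) o) * Φ (K * b ^ dist o ((g : X ≃ᵢ X) o)))))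
  refine measure_mono_null ?_ (measure_wellApproximable_eq_zero_of_subset hb hvis hG hδ hqc hμξ
    hΦ hΦ' hTG (mul_pos hC0 hK) hsumT)
  intro η hη K₁ hK₁
  -- The extra factor pays for replacing g by gh, whose displacement satisfies l_(gh) ≤ M C² A l_g
  -- (`hkl`).
  obtain ⟨g, hg, hgη⟩ := hη.2 (K₁ * (M * C ^ 2 * A)) (by positivity)
  -- The covering is applied to the orbit point g⁻¹o, so the point of S obtained is (gh)⁻¹o.
  obtain ⟨h, hh, hhξ, s, hs, hsg⟩ := hcover g⁻¹ (G.inv_mem hg)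
  have hkξ : boundaryMap (g * h) ξ = boundaryMap g ξ := by rw [boundaryMap_mul, hhξ]
  obtain ⟨y, rfl⟩ : ∃ y, s = GromovClosure.inner y := by
    cases s with
    | inner y => exact ⟨y, rfl⟩
    | bdry ζ => simp [closureMap] at hsg
  have hy : y = (g * h)⁻¹ o := by
    simp only [closureMap, GromovClosure.inner.injEq] at hsg
    rw [mul_inv_rev]
    change y = h.symm (g⁻¹ o)
    rw [← hsg, h.symm_apply_apply]
  have hT : boundaryDeriv b o (g * h) ξ * expDisp b o (g * h) ≤ M := by
    rw [hM]
    refine (hC.deriv_le_mixedProduct (g * h) ξ).trans ?_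
    rw [← hy]
    have := ENNReal.toReal_mono ENNReal.coe_ne_top (ht y hs)
    rw [ENNReal.coe_toReal] at this
    have := Real.rpow_le_rpow_of_exponent_le hb.le (mul_le_mul_of_nonneg_left this zero_le_two)
    gcongr
  refine ⟨g * h, ⟨G.mul_mem hg hh, hT⟩, ?_⟩
  rw [hkξ]
  refine hgη.trans ?_
  have hkl : expDisp b o (g * h) ≤ M * C ^ 2 * A * expDisp b o g := by
    have h1 := hC.le_deriv_mul g h ξ
    rw [hhξ] at h1
    have h2 := (hA h hh hhξ).1
    have h3 := hC.one_le_deriv_mul g ξ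
    have h4 : boundaryDeriv b o g ξ ≤ A * (C * boundaryDeriv b o (g * h) ξ) := by
      calc boundaryDeriv b o g ξ = A * (boundaryDeriv b o g ξ * A⁻¹) := by field_simp
        _ ≤ A * (boundaryDeriv b o g ξ * boundaryDeriv b o h ξ) := by
          have := boundaryDeriv_pos (o := o) hb g ξ
          gcongr
        _ ≤ _ := by gcongr
    have := hl g
    have := hl (g * h)
    calc expDisp b o (g * h)
        ≤ C * (boundaryDeriv b o g ξ * expDisp b o g) * expDisp b o (g * h) :=
          le_mul_of_one_le_left (hl _).le h3
      _ ≤ C * (A * (C * boundaryDeriv b o (g * h) ξ) * expDisp b o g) * expDisp b o (g * h) := by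
          gcongr
      _ = C ^ 2 * A * expDisp b o g * (boundaryDeriv b o (g * h) ξ * expDisp b o (g * h)) := by
          ring
      _ ≤ C ^ 2 * A * expDisp b o g * M := by gcongr
      _ = _ := by ring
  have h5 := mul_le_of_antitoneOn_mul hΦ hΦ' le_rfl (t := K₁ * expDisp b o (g * h))
    (t' := K₁ * (M * C ^ 2 * A) * b ^ dist o (g o)) (mul_pos hK₁ (hl _)) (by
      rw [one_mul, mul_assoc]
      exact mul_le_mul_of_nonneg_left hkl hK₁.le)
  linarith

end Convergence

/-! ### Selection of separated centres -/

section Separated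

variable {ι Z : Type*} [MetricSpace Z]

/-- Greedy selection in order of decreasing e: an index is kept unless its point is within its own
scale of a point already chosen. -/
theorem exists_separated_subset (x : ι → Z) (e : ι → ℝ) (F : Finset ι) :
    ∃ S ⊆ F, (∀ g ∈ S, ∀ h ∈ S, g ≠ h → e h ≤ e g → e h < dist (x g) (x h)) ∧
      ∀ t ∈ F, ∃ s ∈ S, t = s ∨ (e t ≤ e s ∧ dist (x s) (x t) ≤ e t) := by
  classical
  induction F using Finset.induction_on_min_value e with
  | empty => exact ⟨∅, by simp⟩
  | insert m F hm hmin ih =>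
    obtain ⟨S, hSF, hS, hcov⟩ := ih
    by_cases h : ∃ s ∈ S, dist (x s) (x m) ≤ e m
    · refine ⟨S, hSF.trans (Finset.subset_insert _ _), hS, fun t ht => ?_⟩
      rcases Finset.mem_insert.1 ht with rfl | ht
      · obtain ⟨s, hs, hd⟩ := h
        exact ⟨s, hs, .inr ⟨hmin s (hSF hs), hd⟩⟩
      · exact hcov t ht
    · push Not at h
      refine ⟨insert m S, Finset.insert_subset_insert _ hSF, fun g hg k hk hne hle => ?_,
        fun t ht => ?_⟩
      · rcases Finset.mem_insert.1 hg with hgm | hg' <;>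
          rcases Finset.mem_insert.1 hk with hkm | hk'
        · exact absurd (hgm.trans hkm.symm) hne
        · subst hgm
          rw [dist_comm]
          exact hle.trans_lt (h k hk')
        · subst hkm
          exact h g hg'
        · exact hS g hg' k hk' hne hle
      · rcases Finset.mem_insert.1 ht with rfl | ht
        · exact ⟨t, Finset.mem_insert_self _ _, .inl rfl⟩
        · obtain ⟨s, hs, hst⟩ := hcov t ht
          exact ⟨s, Finset.mem_insert_of_mem hs, hst⟩

end Separated

/-! ### Positivity of the exponent -/

section Exponent

variable {X : Type*} [MetricSpace X] [GromovHyperbolic X]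

theorem boundaryMap_iterate (g : X ≃ᵢ X) (n : ℕ) : (boundaryMap g)^[n] = boundaryMap (g ^ n) := by
  induction n with
  | zero => funext η; rw [pow_zero, boundaryMap_one]; rfl
  | succ n ih => funext η; rw [Function.iterate_succ_apply', ih, pow_succ', boundaryMap_mul]

variable [MetricSpace (GromovBoundary X)]
  {b : ℝ} {o : X} {C : ℝ} {G : Subgroup (X ≃ᵢ X)}

theorem IsGeneralType.exists_boundaryMap_ne (hG' : IsGeneralType G) (ξ : GromovBoundary X) :
    ∃ f ∈ G, boundaryMap f ξ ≠ ξ := by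
  obtain ⟨g₁, h₁, g₂, h₂, -, -, hdis⟩ := hG'
  by_contra! h
  exact Set.disjoint_left.1 hdis (h g₁ h₁) (h g₂ h₂)

variable [MeasurableSpace (GromovBoundary X)] [BorelSpace (GromovBoundary X)]
  {μ : Measure (GromovBoundary X)} [IsProbabilityMeasure μ]

/-- With exponent 0 the group distorts μ by bounded factors only. Powers of g push the complement of
any neighbourhood of q, minus p, into punctured balls around p whose measures tend to 0; so μ lives
on {p, q}. -/
theorem IsLoxodromic.exists_measure_compl_eq_zero (hb : 1 < b)
    (hqc : IsQuasiconformal b o G 0 μ) {g : X ≃ᵢ X} (hg : g ∈ G) (h : IsLoxodromic g) :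
    ∃ A ⊆ Function.fixedPoints (boundaryMap g), μ Aᶜ = 0 := by
  obtain ⟨p, q, -, hp, hq, hunif, -⟩ := h
  obtain ⟨Q, hQ⟩ := hqc.exists_bounds hb le_rfl
  have hle : ∀ k ∈ G, ∀ A : Set (GromovBoundary X), MeasurableSet A →
      μ A ≤ Q * μ (boundaryMap k '' A) := fun k hk A hA => by
    simpa using (hQ k hk A hA 0 le_rfl).2 fun η _ => (boundaryDeriv_pos hb k η).le
  refine ⟨{p, q}, ?_, ?_⟩
  · rintro _ (rfl | rfl)
    exacts [hp, hq]
  have hlim : Tendsto (fun n : ℕ => μ (Metric.ball p (1 / ((n : ℝ) + 1)) \ {p})) atTop (𝓝 0) := by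
    have h1 : ⋂ n : ℕ, Metric.ball p (1 / ((n : ℝ) + 1)) \ {p} = ∅ := by
      refine eq_empty_iff_forall_notMem.2 fun η hη => ?_
      rw [mem_iInter] at hη
      have hd : 0 < dist η p := dist_pos.2 (hη 0).2
      obtain ⟨n, hn⟩ := exists_nat_one_div_lt hd
      exact lt_asymm hn (hη n).1
    have h2 := tendsto_measure_iInter_atTop (μ := μ)
      (s := fun n : ℕ => Metric.ball p (1 / ((n : ℝ) + 1)) \ {p})
      (fun n => (measurableSet_ball.diff (measurableSet_singleton p)).nullMeasurableSet)
      (fun m n hmn => sdiff_subset_sdiff_left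
        (Metric.ball_subset_ball (Nat.one_div_le_one_div hmn)))
      ⟨0, measure_ne_top _ _⟩
    rwa [h1, measure_empty] at h2
  have hnull : ∀ U : Set (GromovBoundary X), IsOpen U → q ∈ U → μ (Uᶜ \ {p}) = 0 := by
    intro U hU hqU
    have hA : MeasurableSet (Uᶜ \ {p}) := hU.measurableSet.compl.diff (measurableSet_singleton p)
    have h3 : ∀ n : ℕ, μ (Uᶜ \ {p}) ≤ Q * μ (Metric.ball p (1 / ((n : ℝ) + 1)) \ {p}) := by
      intro n
      obtain ⟨m, hm⟩ := (Metric.tendstoUniformlyOn_iff.1 (hunif U (hU.mem_nhds hqU))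
        (1 / ((n : ℝ) + 1)) (by positivity)).exists
      refine (hle (g ^ m) (G.pow_mem hg m) _ hA).trans ?_
      gcongr
      rintro _ ⟨η, ⟨hη, hηp⟩, rfl⟩
      have hpm : boundaryMap (g ^ m) p = p := by
        rw [← boundaryMap_iterate]; exact Function.iterate_fixed hp m
      refine ⟨?_, fun h => hηp (boundaryMap_injective (g ^ m) (h.trans hpm.symm))⟩
      rw [Metric.mem_ball, dist_comm, ← boundaryMap_iterate]
      exact hm η hη
    have h4 : Tendsto (fun n : ℕ => (Q : ℝ≥0∞) * μ (Metric.ball p (1 / ((n : ℝ) + 1)) \ {p}))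
        atTop (𝓝 0) := by
      simpa using ENNReal.Tendsto.const_mul hlim (.inr ENNReal.coe_ne_top)
    exact le_antisymm (ge_of_tendsto' h4 h3) bot_le
  refine measure_mono_null (t := ⋃ n : ℕ, (Metric.ball q (1 / ((n : ℝ) + 1)))ᶜ \ {p}) ?_
    (measure_iUnion_null fun n => hnull _ Metric.isOpen_ball
      (Metric.mem_ball_self (by positivity)))
  intro η hη
  simp only [mem_compl_iff, mem_insert_iff, mem_singleton_iff, not_or] at hη
  obtain ⟨n, hn⟩ := exists_nat_one_div_lt (dist_pos.2 hη.2)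
  exact mem_iUnion.2 ⟨n, not_lt.2 hn.le, hη.1⟩

theorem IsGeneralType.exponent_ne_zero (hb : 1 < b)
    (hG' : IsGeneralType G) : ¬ IsQuasiconformal b o G 0 μ := by
  intro hqc
  obtain ⟨g₁, h₁, g₂, h₂, hl₁, hl₂, hdis⟩ := hG'
  obtain ⟨A₁, hA₁, hμ₁⟩ := hl₁.exists_measure_compl_eq_zero hb hqc h₁
  obtain ⟨A₂, hA₂, hμ₂⟩ := hl₂.exists_measure_compl_eq_zero hb hqc h₂
  have h : A₁ᶜ ∪ A₂ᶜ = univ := by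
    rw [← compl_inter, (hdis.mono hA₁ hA₂).inter_eq, compl_empty]
  have := measure_union_null hμ₁ hμ₂
  rw [h, measure_univ] at this
  exact one_ne_zero this

end Exponent

/-! ### Contracting elements: shadows and shell counting -/

section GoodElements

variable {X : Type*} [MetricSpace X] [GromovHyperbolic X] [MetricSpace (GromovBoundary X)]
  {b : ℝ} {o : X} {C : ℝ} {G : Subgroup (X ≃ᵢ X)}

/-- The elements of `G` that contract near `ξ` as strongly as they can, up to a factor `M`. -/
def contracting (b : ℝ) (o : X) (G : Subgroup (X ≃ᵢ X)) (ξ : GromovBoundary X) (M : ℝ) :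
    Set (X ≃ᵢ X) :=
  {g | g ∈ G ∧ boundaryDeriv b o g ξ * expDisp b o g ≤ M}

namespace BoundaryGeometry

/-- Says coarsely that ⟨po|pξ⟩_o ≥ d(o,po) up to a constant: pξ lies in the shadow of po. It follows
from (p⁻¹)'(pξ) p'(ξ) ≍ 1. -/
theorem sq_le_deriv_inv (hC : BoundaryGeometry X b o C) (hb : 1 < b) {M : ℝ}
    {ξ : GromovBoundary X} {p : X ≃ᵢ X} (hp : p ∈ contracting b o G ξ M) :
    expDisp b o p ^ 2 ≤
      C * M * (boundaryDeriv b o p⁻¹ (boundaryMap p ξ) * expDisp b o p⁻¹) := by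
  have h1 := hC.one_le_deriv_inv p ξ
  have hC0 := hC.pos
  have hl := expDisp_pos (o := o) hb p
  have hv := boundaryDeriv_pos (o := o) hb p⁻¹ (boundaryMap p ξ)
  rw [expDisp_inv]
  calc expDisp b o p ^ 2 ≤ C * (boundaryDeriv b o p⁻¹ (boundaryMap p ξ) * boundaryDeriv b o p ξ)
        * expDisp b o p ^ 2 := le_mul_of_one_le_left (by positivity) h1
    _ = C * boundaryDeriv b o p⁻¹ (boundaryMap p ξ) * expDisp b o p *
        (boundaryDeriv b o p ξ * expDisp b o p) := by ring
    _ ≤ C * boundaryDeriv b o p⁻¹ (boundaryMap p ξ) * expDisp b o p * M := by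
        gcongr; exact hp.2
    _ = _ := by ring

theorem sq_le_deriv_inv_of_near (hC : BoundaryGeometry X b o C) (hb : 1 < b) {M : ℝ} (hM : 1 ≤ M)
    {ξ y : GromovBoundary X} {p : X ≃ᵢ X} (hp : p ∈ contracting b o G ξ M)
    (hy : dist y (boundaryMap p ξ) * expDisp b o p ≤ 2) :
    expDisp b o p ^ 2 / (4 * C ^ 2 * M) ≤ boundaryDeriv b o p⁻¹ y * expDisp b o p⁻¹ := by
  have hC0 := hC.pos
  have hl := expDisp_pos (o := o) hb p
  have h1 := hC.sq_le_deriv_inv hb hp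
  have h2 : 0 < expDisp b o p ^ 2 / (4 * C * M) := by positivity
  have h3 := hC.near p⁻¹ (boundaryMap p ξ) y (expDisp b o p ^ 2 / (4 * C * M)) h2
    (by rw [div_le_iff₀ (by positivity)]
        refine h1.trans ?_
        have hv := boundaryDeriv_pos (o := o) hb p⁻¹ (boundaryMap p ξ)
        have hl' := expDisp_pos (o := o) hb p⁻¹
        have : 0 ≤ C * M * (boundaryDeriv b o p⁻¹ (boundaryMap p ξ) * expDisp b o p⁻¹) := by
          positivity
        linarith)
    (by rw [dist_comm, div_mul_eq_mul_div, div_le_one (by positivity)]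
        calc expDisp b o p ^ 2 * dist y (boundaryMap p ξ) ^ 2
            = (dist y (boundaryMap p ξ) * expDisp b o p) ^ 2 := by ring
          _ ≤ 2 ^ 2 := by gcongr
          _ ≤ 4 * (C * M) := by nlinarith [hC.one_le]
          _ = 4 * C * M := by ring)
  rw [div_le_iff₀ (by positivity)] at h3 ⊢
  refine h3.trans (le_of_eq ?_)
  ring

/-- Bounds the measure of a set near pξ by about l_p^(-δ) times that of its preimage, through
quasiconformality. -/
theorem deriv_le_of_near_image (hC : BoundaryGeometry X b o C) (hb : 1 < b) {M : ℝ} (hM : 1 ≤ M)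
    {ξ y : GromovBoundary X} {p : X ≃ᵢ X} (hp : p ∈ contracting b o G ξ M)
    (hy : dist y (boundaryMap p ξ) * expDisp b o p ≤ 2) :
    boundaryDeriv b o p (boundaryMap p⁻¹ y) ≤ 4 * C ^ 3 * M * (expDisp b o p)⁻¹ := by
  have hC0 := hC.pos
  have hl := expDisp_pos (o := o) hb p
  have h1 := hC.sq_le_deriv_inv_of_near hb hM hp hy
  have h2 := hC.deriv_inv_le p (boundaryMap p⁻¹ y)
  rw [boundaryMap_apply_inv] at h2
  have hz := boundaryDeriv_pos (o := o) hb p (boundaryMap p⁻¹ y)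
  rw [expDisp_inv, div_le_iff₀ (by positivity)] at h1
  rw [← div_eq_mul_inv, le_div_iff₀ hl]
  have h3 : expDisp b o p * (boundaryDeriv b o p (boundaryMap p⁻¹ y) * expDisp b o p) ≤
      expDisp b o p * (4 * C ^ 3 * M) := by
    calc _ = expDisp b o p ^ 2 * boundaryDeriv b o p (boundaryMap p⁻¹ y) := by ring
      _ ≤ boundaryDeriv b o p⁻¹ y * expDisp b o p * (4 * C ^ 2 * M) *
          boundaryDeriv b o p (boundaryMap p⁻¹ y) := by gcongr
      _ = (boundaryDeriv b o p⁻¹ y * boundaryDeriv b o p (boundaryMap p⁻¹ y)) *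
          (expDisp b o p * (4 * C ^ 2 * M)) := by ring
      _ ≤ C * (expDisp b o p * (4 * C ^ 2 * M)) := by gcongr
      _ = _ := by ring
  exact le_of_mul_le_mul_left h3 hl

/-- Since hξ lies in the shadows of both po and ho, the orbit point po is near a path from o to ho,
so d(po,ho) is at most d(o,ho) - d(o,po) plus a constant. -/
theorem expDisp_inv_mul_le (hC : BoundaryGeometry X b o C) (hb : 1 < b) {M : ℝ} (hM : 1 ≤ M)
    {ξ : GromovBoundary X} {p h : X ≃ᵢ X} (hp : p ∈ contracting b o G ξ M)
    (hh : h ∈ contracting b o G ξ M) (hle : expDisp b o p ≤ expDisp b o h)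
    (hd : dist (boundaryMap h ξ) (boundaryMap p ξ) * expDisp b o p ≤ 2) :
    expDisp b o (p⁻¹ * h) * expDisp b o p ≤ 4 * C ^ 3 * M * expDisp b o h := by
  have hC0 := hC.pos
  have hC1 := hC.one_le
  have hl := expDisp_pos (o := o) hb p
  have hlh := expDisp_pos (o := o) hb h
  have hlk := expDisp_pos (o := o) hb (p⁻¹ * h)
  have h1 := hC.sq_le_deriv_inv_of_near hb hM hp hd
  have h2 := hC.sq_le_deriv_inv hb hh
  have h3 := hC.near_inner p⁻¹ h⁻¹ (boundaryMap h ξ) (expDisp b o p ^ 2 / (4 * C ^ 2 * M))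
    (by positivity) h1 (by
      rw [div_le_iff₀ (by positivity)]
      calc expDisp b o p ^ 2 ≤ expDisp b o h ^ 2 := by gcongr
        _ ≤ _ := h2
        _ ≤ boundaryDeriv b o h⁻¹ (boundaryMap h ξ) * expDisp b o h⁻¹ * (4 * C ^ 2 * M) := by
          rw [mul_comm]
          have hv := boundaryDeriv_pos (o := o) hb h⁻¹ (boundaryMap h ξ)
          have hl' := expDisp_pos (o := o) hb h⁻¹
          gcongr
          nlinarith)
  rw [inv_inv, expDisp_inv, expDisp_inv, div_mul_eq_mul_div, div_le_iff₀ (by positivity)] at h3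
  have h4 : expDisp b o p * (expDisp b o (p⁻¹ * h) * expDisp b o p) ≤
      expDisp b o p * (4 * C ^ 3 * M * expDisp b o h) := by
    linarith
  exact le_of_mul_le_mul_left h4 hl

theorem deriv_mul_le_of_near (hC : BoundaryGeometry X b o C) (hb : 1 < b) {M : ℝ} (hM : 1 ≤ M)
    {ξ η : GromovBoundary X} {g : X ≃ᵢ X} (hg : g ∈ contracting b o G ξ M)
    (hη : dist η ξ * (C * M + 1) ≤ 1) :
    boundaryDeriv b o g η * expDisp b o g ≤ C * M := by
  have hC0 := hC.pos
  have hv := boundaryDeriv_pos (o := o) hb g η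
  have hl := expDisp_pos (o := o) hb g
  have hM0 : 0 < C * M := by positivity
  by_contra! hlt
  have h1 : C * M + 1 ≤ (C * M + 1) ^ 2 := by nlinarith
  -- `near` needs s·dist² ≤ 1, so the value is capped at CM + 1, which still exceeds CM.
  set s := min (boundaryDeriv b o g η * expDisp b o g) (C * M + 1)
  have hs : C * M < s := lt_min hlt (by linarith)
  have h2 := hC.near g η ξ s (hM0.trans hs) (min_le_left _ _) (by
    calc s * dist η ξ ^ 2 ≤ (C * M + 1) ^ 2 * dist η ξ ^ 2 := by
          gcongr; exact (min_le_right _ _).trans h1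
      _ = (dist η ξ * (C * M + 1)) ^ 2 := by ring
      _ ≤ 1 := pow_le_one₀ (by positivity) hη)
  have h3 : C * (boundaryDeriv b o g ξ * expDisp b o g) ≤ C * M := by
    gcongr; exact hg.2
  linarith

theorem dist_map_le_of_near (hC : BoundaryGeometry X b o C) (hb : 1 < b) {M : ℝ} (hM : 1 ≤ M)
    {ξ η : GromovBoundary X} {g : X ≃ᵢ X} (hg : g ∈ contracting b o G ξ M)
    (hη : dist η ξ * (C * M + 1) ≤ 1) :
    dist (boundaryMap g η) (boundaryMap g ξ) * expDisp b o g ≤ C * M * dist η ξ := by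
  have hC0 := hC.pos
  have hl := expDisp_pos (o := o) hb g
  have hv := boundaryDeriv_pos (o := o) hb g ξ
  have h1 := hC.deriv_mul_le_of_near hb hM hg hη
  refine le_of_sq_le_sq ?_ (by positivity)
  calc (dist (boundaryMap g η) (boundaryMap g ξ) * expDisp b o g) ^ 2
      = dist (boundaryMap g η) (boundaryMap g ξ) ^ 2 * expDisp b o g ^ 2 := by ring
    _ ≤ C * (boundaryDeriv b o g η * boundaryDeriv b o g ξ * dist η ξ ^ 2) *
        expDisp b o g ^ 2 := by gcongr; exact hC.dist_map_sq_le g η ξ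
    _ = C * ((boundaryDeriv b o g η * expDisp b o g) * (boundaryDeriv b o g ξ * expDisp b o g)) *
        dist η ξ ^ 2 := by ring
    _ ≤ C * (C * M * M) * dist η ξ ^ 2 := by gcongr; exact hg.2
    _ = (C * M * dist η ξ) ^ 2 := by ring

/-- Two elements of one shell whose shadows contain y differ by an element of bounded displacement;
strong discreteness leaves finitely many of these, independently of y. -/
theorem exists_card_le (hC : BoundaryGeometry X b o C) (hb : 1 < b) (hG : StronglyDiscrete o G)
    {M : ℝ} (hM : 1 ≤ M) (ξ : GromovBoundary X) :
    ∃ N : ℕ, ∀ (F : Finset (X ≃ᵢ X)) (y : GromovBoundary X),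
      (∀ h ∈ F, h ∈ contracting b o G ξ M ∧ dist y (boundaryMap h ξ) ≤ (expDisp b o h)⁻¹) →
      (∀ h ∈ F, ∀ k ∈ F, expDisp b o k ≤ b * expDisp b o h) → F.card ≤ N := by
  classical
  have hfin := hG.finite_expDisp_le hb (4 * C ^ 3 * M * b)
  refine ⟨hfin.toFinset.card, fun F y hF hshell => ?_⟩
  rcases F.eq_empty_or_nonempty with rfl | ⟨h₀, hh₀⟩
  · simp
  have key : ∀ h ∈ F, ∀ k ∈ F, expDisp b o h ≤ expDisp b o k →
      expDisp b o (h⁻¹ * k) ≤ 4 * C ^ 3 * M * b := by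
    intro h hh k hk hle
    have hl := expDisp_pos (o := o) hb h
    have hlk := expDisp_pos (o := o) hb k
    have hC0 := hC.pos
    have h1 : dist (boundaryMap k ξ) (boundaryMap h ξ) * expDisp b o h ≤ 2 := by
      have h2 := dist_triangle_left (boundaryMap k ξ) (boundaryMap h ξ) y
      have h3 := (hF k hk).2.trans (inv_anti₀ hl hle)
      calc _ ≤ (2 * (expDisp b o h)⁻¹) * expDisp b o h := by
            gcongr; linarith [(hF h hh).2]
        _ = 2 := by field_simp
    have h4 := hC.expDisp_inv_mul_le hb hM (hF h hh).1 (hF k hk).1 hle h1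
    refine le_of_mul_le_mul_right (h4.trans ?_) hl
    rw [mul_assoc _ b]
    gcongr
    exact hshell h hh k hk
  refine Finset.card_le_card_of_injOn (fun k => h₀⁻¹ * k) (fun k hk => ?_)
    (fun a _ c _ h => mul_left_cancel h)
  rw [Finset.mem_coe, hfin.mem_toFinset]
  refine ⟨G.mul_mem (G.inv_mem (hF h₀ hh₀).1.1) (hF k hk).1.1, ?_⟩
  rcases le_total (expDisp b o h₀) (expDisp b o k) with hle | hle
  · exact key h₀ hh₀ k hk hle
  · rw [← expDisp_inv, mul_inv_rev, inv_inv]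
    exact key k hk h₀ hh₀ hle

/-- Sorts the elements shadowed by s into shells. Each shell has boundedly many of them, ψ only
decreases, and l^(-δ) decays geometrically because δ > 0. -/
theorem exists_sum_le (hC : BoundaryGeometry X b o C) (hb : 1 < b) (hG : StronglyDiscrete o G)
    {M : ℝ} (hM : 1 ≤ M) (ξ : GromovBoundary X) {δ : ℝ} (hδ : 0 < δ) :
    ∃ A : ℝ≥0∞, A ≠ ∞ ∧ ∀ ψ : ℝ → ℝ≥0∞, AntitoneOn ψ (Ioi 0) →
      ∀ (F : Finset (X ≃ᵢ X)) (s : X ≃ᵢ X),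
      (∀ h ∈ F, h ∈ contracting b o G ξ M ∧ expDisp b o s ≤ expDisp b o h ∧
        dist (boundaryMap s ξ) (boundaryMap h ξ) ≤ (expDisp b o h)⁻¹) →
      ∑ h ∈ F, ENNReal.ofReal (expDisp b o h ^ (-δ)) * ψ (expDisp b o h) ≤
        A * (ENNReal.ofReal (expDisp b o s ^ (-δ)) * ψ (expDisp b o s)) := by
  classical
  obtain ⟨N, hN⟩ := hC.exists_card_le hb hG hM ξ
  have hb0 : 0 < b := by linarith
  set r : ℝ≥0∞ := ENNReal.ofReal (b ^ (-δ)) with hr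
  have hr1 : r < 1 := by
    rw [hr, ← ENNReal.ofReal_one]
    exact (ENNReal.ofReal_lt_ofReal_iff one_pos).2
      (Real.rpow_lt_one_of_one_lt_of_neg hb (by linarith))
  refine ⟨N * ∑' n : ℕ, r ^ n, ?_, fun ψ hψ F s hF => ?_⟩
  · rw [ENNReal.tsum_geometric]
    exact ENNReal.mul_ne_top (ENNReal.natCast_ne_top N)
      (ENNReal.inv_ne_top.2 (tsub_pos_of_lt hr1).ne')
  have hls := expDisp_pos (o := o) hb s
  let n : (X ≃ᵢ X) → ℕ := fun h => ⌊dist o (h o) - dist o (s o)⌋₊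
  have hdist : ∀ h ∈ F, dist o (s o) ≤ dist o (h o) := fun h hh =>
    (Real.rpow_le_rpow_left_iff hb).1 (hF h hh).2.1
  have hterm : ∀ h ∈ F, ENNReal.ofReal (expDisp b o h ^ (-δ)) * ψ (expDisp b o h) ≤
      r ^ n h * (ENNReal.ofReal (expDisp b o s ^ (-δ)) * ψ (expDisp b o s)) := by
    intro h hh
    rw [← mul_assoc]
    refine mul_le_mul' ?_ (hψ hls (hls.trans_le (hF h hh).2.1) (hF h hh).2.1)
    rw [hr, ← ENNReal.ofReal_pow (by positivity), ← ENNReal.ofReal_mul (by positivity)]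
    refine ENNReal.ofReal_le_ofReal ?_
    rw [expDisp, expDisp, ← Real.rpow_mul hb0.le, ← Real.rpow_mul hb0.le, ← Real.rpow_natCast,
      ← Real.rpow_mul hb0.le, ← Real.rpow_add hb0]
    refine Real.rpow_le_rpow_of_exponent_le hb.le ?_
    have h1 : (n h : ℝ) ≤ dist o (h o) - dist o (s o) :=
      Nat.floor_le (by linarith [hdist h hh])
    nlinarith
  calc ∑ h ∈ F, ENNReal.ofReal (expDisp b o h ^ (-δ)) * ψ (expDisp b o h)
      ≤ ∑ h ∈ F, r ^ n h * (ENNReal.ofReal (expDisp b o s ^ (-δ)) * ψ (expDisp b o s)) :=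
        Finset.sum_le_sum hterm
    _ = (∑ h ∈ F, r ^ n h) * (ENNReal.ofReal (expDisp b o s ^ (-δ)) * ψ (expDisp b o s)) := by
        rw [Finset.sum_mul]
    _ ≤ (N * ∑' n : ℕ, r ^ n) *
        (ENNReal.ofReal (expDisp b o s ^ (-δ)) * ψ (expDisp b o s)) := by
        gcongr
        rw [Finset.sum_comp (fun m : ℕ => r ^ m) n]
        calc ∑ m ∈ F.image n, (F.filter fun h => n h = m).card • r ^ m
            ≤ ∑ m ∈ F.image n, N * r ^ m := by
              refine Finset.sum_le_sum fun m hm => ?_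
              rw [nsmul_eq_mul]
              gcongr
              refine hN _ (boundaryMap s ξ) (fun h hh => ?_) (fun h hh k hk => ?_)
              · have := hF h (Finset.mem_filter.1 hh).1
                exact ⟨this.1, this.2.2⟩
              · obtain ⟨hh, hhm⟩ := Finset.mem_filter.1 hh
                obtain ⟨hk, hkm⟩ := Finset.mem_filter.1 hk
                have h1 : dist o (k o) - dist o (s o) < n k + 1 := Nat.lt_floor_add_one _
                have h2 : (n h : ℝ) ≤ dist o (h o) - dist o (s o) :=
                  Nat.floor_le (by linarith [hdist h hh])
                rw [hkm] at h1
                rw [hhm] at h2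
                calc expDisp b o k ≤ b ^ (1 + dist o (h o)) :=
                      Real.rpow_le_rpow_of_exponent_le hb.le (by linarith)
                  _ = b * expDisp b o h := by rw [Real.rpow_add hb0, Real.rpow_one]; rfl
          _ = N * ∑ m ∈ F.image n, r ^ m := by rw [Finset.mul_sum]
          _ ≤ N * ∑' n : ℕ, r ^ n := by gcongr; exact ENNReal.sum_le_tsum _

end BoundaryGeometry

end GoodElements

theorem sum_biUnion_le {ι κ : Type*} [DecidableEq ι] (f : ι → ℝ≥0∞) (S : Finset κ)
    (N : κ → Finset ι) : ∑ i ∈ S.biUnion N, f i ≤ ∑ s ∈ S, ∑ i ∈ N s, f i := by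
  classical
  induction S using Finset.induction_on with
  | empty => simp
  | insert a S ha ih =>
    rw [Finset.biUnion_insert, Finset.sum_insert ha]
    refine le_trans ?_ (add_le_add_right ih _)
    rw [← Finset.sum_union_inter]
    exact le_self_add

/-! ### Divergence case -/

section Divergence

variable {X : Type*} [MetricSpace X] [GromovHyperbolic X] [MetricSpace (GromovBoundary X)]
  {b : ℝ} {o : X} {C : ℝ} {G : Subgroup (X ≃ᵢ X)}

/-- The points within `Φ(K b^(d(o, g o)))` of `g ξ` for some `g` in `G`. -/
def approximable (b : ℝ) (o : X) (G : Subgroup (X ≃ᵢ X)) (ξ : GromovBoundary X) (Φ : ℝ → ℝ)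
    (K : ℝ) : Set (GromovBoundary X) :=
  ⋃ g : G, Metric.closedBall (boundaryMap (g : X ≃ᵢ X) ξ) (Φ (K * expDisp b o (g : X ≃ᵢ X)))

theorem mem_approximable {ξ η : GromovBoundary X} {Φ : ℝ → ℝ} {K : ℝ} :
    η ∈ approximable b o G ξ Φ K ↔
      ∃ g ∈ G, dist (boundaryMap g ξ) η ≤ Φ (K * expDisp b o g) := by
  simp only [approximable, mem_iUnion, Metric.mem_closedBall, dist_comm η, Subtype.exists,
    exists_prop]

theorem approximable_anti (hb : 1 < b) {ξ : GromovBoundary X} {Φ : ℝ → ℝ}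
    (hΦ : ∀ t, 0 < t → 0 < Φ t) (hΦ' : AntitoneOn (fun t => t * Φ t) (Ioi 0)) {K K' : ℝ}
    (hK : 0 < K) (h : K ≤ K') : approximable b o G ξ Φ K' ⊆ approximable b o G ξ Φ K := by
  intro η hη
  rw [mem_approximable] at hη ⊢
  obtain ⟨g, hg, hgη⟩ := hη
  have hl := expDisp_pos (o := o) hb g
  have := mul_le_of_antitoneOn_mul hΦ hΦ' le_rfl (mul_pos hK hl)
    (t' := K' * expDisp b o g) (by rw [one_mul]; gcongr)
  exact ⟨g, hg, hgη.trans (by linarith)⟩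

theorem image_iInter_approximable (hb : 1 < b) (hC : BoundaryGeometry X b o C)
    {ξ : GromovBoundary X} {Φ : ℝ → ℝ} (hΦ : ∀ t, 0 < t → 0 < Φ t)
    (hΦ' : AntitoneOn (fun t => t * Φ t) (Ioi 0)) {f : X ≃ᵢ X} (hf : f ∈ G) :
    boundaryMap f '' (⋂ n : ℕ, approximable b o G ξ Φ (n + 1)) =
      ⋂ n : ℕ, approximable b o G ξ Φ (n + 1) := by
  have hC0 := hC.pos
  have key : ∀ f ∈ G, boundaryMap f '' (⋂ n : ℕ, approximable b o G ξ Φ (n + 1)) ⊆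
      ⋂ n : ℕ, approximable b o G ξ Φ (n + 1) := by
    rintro f hf _ ⟨η, hη, rfl⟩
    refine mem_iInter.2 fun n => ?_
    have hlf := one_le_expDisp (o := o) hb f
    -- One factor l_f comes from the Lipschitz constant C² l_f of f, the other from l_(fg) ≤ l_f
    -- l_g.
    obtain ⟨m, hm⟩ := exists_nat_ge (C ^ 2 * expDisp b o f * ((n + 1) * expDisp b o f))
    obtain ⟨g, hg, hgη⟩ := mem_approximable.1 (mem_iInter.1 hη m)
    have hlg := expDisp_pos (o := o) hb g
    have hlfg := expDisp_pos (o := o) hb (f * g)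
    refine mem_approximable.2 ⟨f * g, G.mul_mem hf hg, ?_⟩
    rw [boundaryMap_mul]
    refine (hC.dist_map_le hb f _ _).trans (le_trans (b := C ^ 2 * expDisp b o f *
      Φ ((m + 1) * expDisp b o g)) (by gcongr) ?_)
    refine mul_le_of_antitoneOn_mul hΦ hΦ'
      (one_le_mul_of_one_le_of_one_le (one_le_pow₀ hC.one_le) hlf) (by positivity) ?_
    calc C ^ 2 * expDisp b o f * ((n + 1) * expDisp b o (f * g))
        ≤ C ^ 2 * expDisp b o f * ((n + 1) * (expDisp b o f * expDisp b o g)) := by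
          gcongr; exact expDisp_mul_le hb f g
      _ = C ^ 2 * expDisp b o f * ((n + 1) * expDisp b o f) * expDisp b o g := by ring
      _ ≤ (m + 1) * expDisp b o g := by gcongr; linarith
  refine Subset.antisymm (key f hf) fun η hη => ⟨boundaryMap f⁻¹ η, ?_, boundaryMap_apply_inv f η⟩
  exact key f⁻¹ (G.inv_mem hf) (mem_image_of_mem _ hη)

/-- By Gromov's inequality g⁻¹o cannot be close to both ξ and fξ. If it is far from ξ then g is
contracting at ξ; if it is far from fξ then gf is, by the chain rule. -/
theorem exists_contracting (hb : 1 < b) (hC : BoundaryGeometry X b o C) {ξ : GromovBoundary X}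
    {f : X ≃ᵢ X} (hf : f ∈ G) (hfξ : boundaryMap f ξ ≠ ξ) :
    ∃ M : ℝ, 1 ≤ M ∧ ∀ g ∈ G, g ∈ contracting b o G ξ M ∨ g * f ∈ contracting b o G ξ M := by
  have hC0 := hC.pos
  have hD : 0 < dist ξ (boundaryMap f ξ) := dist_pos.2 hfξ.symm
  set D := dist ξ (boundaryMap f ξ)
  have hlf := expDisp_pos (o := o) hb f
  refine ⟨max 1 (max (C / D ^ 2) (C * (C / D ^ 2 * (C * expDisp b o f * expDisp b o f)))),
    le_max_left _ _, fun g hg => ?_⟩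
  have hlg := expDisp_pos (o := o) hb g
  have h1 := boundaryDeriv_pos (o := o) hb g ξ
  have h2 := boundaryDeriv_pos (o := o) hb g (boundaryMap f ξ)
  rcases le_total (boundaryDeriv b o g ξ * expDisp b o g)
    (boundaryDeriv b o g (boundaryMap f ξ) * expDisp b o g) with h | h
  · have h3 := hC.near_of_deriv g ξ (boundaryMap f ξ) _ (by positivity) le_rfl h
    rw [← le_div_iff₀ (by positivity)] at h3
    exact .inl ⟨hg, h3.trans ((le_max_left _ _).trans (le_max_right _ _))⟩
  · have h3 := hC.near_of_deriv g ξ (boundaryMap f ξ) _ (by positivity) h le_rfl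
    rw [← le_div_iff₀ (by positivity)] at h3
    refine .inr ⟨G.mul_mem hg hf, le_trans ?_ ((le_max_right _ _).trans (le_max_right _ _))⟩
    have h4 := boundaryDeriv_pos (o := o) hb f ξ
    have h5 := expDisp_pos (o := o) hb (g * f)
    calc boundaryDeriv b o (g * f) ξ * expDisp b o (g * f)
        ≤ C * (boundaryDeriv b o g (boundaryMap f ξ) * boundaryDeriv b o f ξ) *
            (expDisp b o g * expDisp b o f) := by
          gcongr
          · exact hC.deriv_mul_le g f ξ
          · exact expDisp_mul_le hb g f
      _ = C * (boundaryDeriv b o g (boundaryMap f ξ) * expDisp b o g *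
            (boundaryDeriv b o f ξ * expDisp b o f)) := by ring
      _ ≤ C * (C / D ^ 2 * (C * expDisp b o f * expDisp b o f)) := by
          gcongr
          exact hC.deriv_le f ξ

variable [MeasurableSpace (GromovBoundary X)]

/-- The general term of the series of Khinchin type. -/
noncomputable def khinchinTerm (b : ℝ) (o : X) (δ : ℝ) (μ : Measure (GromovBoundary X))
    (ξ : GromovBoundary X) (Φ : ℝ → ℝ) (K : ℝ) (g : X ≃ᵢ X) : ℝ≥0∞ :=
  ENNReal.ofReal (expDisp b o g ^ (-δ)) *
    μ (Metric.closedBall ξ (expDisp b o g * Φ (K * expDisp b o g)))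

theorem khinchinSeries_eq_tsum (hb : 1 < b) {δ : ℝ} {μ : Measure (GromovBoundary X)}
    {ξ : GromovBoundary X} {Φ : ℝ → ℝ} {K : ℝ} :
    khinchinSeries b o G δ μ ξ Φ K =
      ∑' g, (G : Set (X ≃ᵢ X)).indicator (khinchinTerm b o δ μ ξ Φ K) g := by
  rw [← tsum_subtype]
  refine tsum_congr fun g => ?_
  rw [khinchinTerm, expDisp, ← Real.rpow_mul (by linarith), mul_comm (dist _ _)]

theorem khinchinTerm_le_mul (hb : 1 < b) {δ : ℝ} (hδ : 0 ≤ δ) {μ : Measure (GromovBoundary X)}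
    {ξ : GromovBoundary X} {Φ : ℝ → ℝ} (hΦ : ∀ t, 0 < t → 0 < Φ t)
    (hΦ' : AntitoneOn (fun t => t * Φ t) (Ioi 0)) {K : ℝ} (hK : 0 < K) (g f : X ≃ᵢ X) :
    khinchinTerm b o δ μ ξ Φ (K * expDisp b o f) g ≤
      ENNReal.ofReal (expDisp b o f ^ δ) * khinchinTerm b o δ μ ξ Φ K (g * f) := by
  have hg := expDisp_pos (o := o) hb g
  have hf := expDisp_pos (o := o) hb f
  have hgf := expDisp_pos (o := o) hb (g * f)
  have hf1 := one_le_expDisp (o := o) hb f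
  have hle := expDisp_mul_le (o := o) hb g f
  rw [khinchinTerm, khinchinTerm, ← mul_assoc, ← ENNReal.ofReal_mul (by positivity)]
  refine mul_le_mul' (ENNReal.ofReal_le_ofReal ?_) (measure_mono
    (Metric.closedBall_subset_closedBall ?_))
  · rw [Real.rpow_neg hg.le, Real.rpow_neg hgf.le, ← div_eq_mul_inv,
      ← Real.div_rpow hf.le hgf.le, ← Real.inv_rpow hg.le]
    refine Real.rpow_le_rpow (by positivity) ?_ hδ
    rw [inv_eq_one_div, div_le_div_iff₀ hg hgf, one_mul, mul_comm]
    exact hle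
  · have h1 : K * expDisp b o f * expDisp b o g *
        Φ (K * expDisp b o f * expDisp b o g) ≤
        K * expDisp b o (g * f) * Φ (K * expDisp b o (g * f)) :=
      hΦ' (mul_pos hK hgf) (mul_pos (mul_pos hK hf) hg) (by
        rw [mul_assoc, mul_comm (expDisp b o f)]; gcongr)
    have h2 := hΦ (K * expDisp b o f * expDisp b o g) (by positivity)
    refine le_of_mul_le_mul_left ?_ hK
    calc K * (expDisp b o g * Φ (K * expDisp b o f * expDisp b o g))
        ≤ K * (expDisp b o f * expDisp b o g * Φ (K * expDisp b o f * expDisp b o g)) := by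
          gcongr; exact le_mul_of_one_le_left hg.le hf1
      _ ≤ _ := by linarith

theorem khinchinSeries_le (hb : 1 < b) {δ : ℝ} (hδ : 0 ≤ δ) {μ : Measure (GromovBoundary X)}
    {ξ : GromovBoundary X} {Φ : ℝ → ℝ} (hΦ : ∀ t, 0 < t → 0 < Φ t)
    (hΦ' : AntitoneOn (fun t => t * Φ t) (Ioi 0)) {K : ℝ} (hK : 0 < K) {f : X ≃ᵢ X} {M : ℝ}
    (hM : ∀ g ∈ G, g ∈ contracting b o G ξ M ∨ g * f ∈ contracting b o G ξ M) :
    khinchinSeries b o G δ μ ξ Φ (K * expDisp b o f) ≤ ENNReal.ofReal (expDisp b o f ^ δ) * 2 *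
      ∑' g, (contracting b o G ξ M).indicator (khinchinTerm b o δ μ ξ Φ K) g := by
  set T := contracting b o G ξ M
  have hf1 : 1 ≤ expDisp b o f ^ δ := Real.one_le_rpow (one_le_expDisp hb f) hδ
  have hf1' : (1 : ℝ≥0∞) ≤ ENNReal.ofReal (expDisp b o f ^ δ) := by
    rwa [ENNReal.one_le_ofReal]
  set B := ENNReal.ofReal (expDisp b o f ^ δ)
  have hpt : ∀ g, (G : Set (X ≃ᵢ X)).indicator (khinchinTerm b o δ μ ξ Φ (K * expDisp b o f)) g ≤
      B * T.indicator (khinchinTerm b o δ μ ξ Φ K) g +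
      B * T.indicator (khinchinTerm b o δ μ ξ Φ K) (g * f) := by
    intro g
    by_cases hg : g ∈ G
    swap
    · rw [indicator_of_notMem hg]; exact bot_le
    rw [indicator_of_mem (show g ∈ (G : Set (X ≃ᵢ X)) from hg)]
    rcases hM g hg with h | h
    · refine le_add_right ?_
      rw [indicator_of_mem h]
      refine le_trans ?_ (le_mul_of_one_le_left bot_le hf1')
      have hlg := expDisp_pos (o := o) hb g
      rw [khinchinTerm, khinchinTerm]
      gcongr
      have := mul_le_of_antitoneOn_mul hΦ hΦ' le_rfl (mul_pos hK hlg)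
        (t' := K * expDisp b o f * expDisp b o g) (by
          rw [one_mul]
          gcongr
          exact le_mul_of_one_le_right hK.le (one_le_expDisp hb f))
      linarith
    · refine le_add_left ?_
      rw [indicator_of_mem h]
      exact khinchinTerm_le_mul hb hδ hΦ hΦ' hK g f
  rw [khinchinSeries_eq_tsum hb]
  refine (ENNReal.tsum_le_tsum hpt).trans (le_of_eq ?_)
  -- The sums run over all isometries with indicators, so right translation by f is a plain
  -- reindexing.
  have hshift : ∑' g, T.indicator (khinchinTerm b o δ μ ξ Φ K) (g * f) =
      ∑' g, T.indicator (khinchinTerm b o δ μ ξ Φ K) g :=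
    (Equiv.mulRight f).tsum_eq (T.indicator (khinchinTerm b o δ μ ξ Φ K))
  rw [ENNReal.tsum_add, ENNReal.tsum_mul_left, ENNReal.tsum_mul_left, hshift]
  ring

variable [BorelSpace (GromovBoundary X)]

theorem measurableSet_approximable (hG : StronglyDiscrete o G) (ξ : GromovBoundary X)
    (Φ : ℝ → ℝ) (K : ℝ) : MeasurableSet (approximable b o G ξ Φ K) := by
  have : Countable G := hG.countable
  exact MeasurableSet.iUnion fun g => measurableSet_closedBall

theorem exists_measure_approximable_le (hb : 1 < b) (hG : StronglyDiscrete o G)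
    {ξ : GromovBoundary X} {Φ : ℝ → ℝ} (hΦ : ∀ t, 0 < t → 0 < Φ t)
    (hΦ' : AntitoneOn (fun t => t * Φ t) (Ioi 0)) {μ : Measure (GromovBoundary X)}
    [IsFiniteMeasure μ] (h : μ (⋂ n : ℕ, approximable b o G ξ Φ (n + 1)) = 0)
    {ε : ℝ≥0∞} (hε : ε ≠ 0) : ∃ K : ℝ, 1 ≤ K ∧ μ (approximable b o G ξ Φ K) ≤ ε := by
  have h1 := tendsto_measure_iInter_atTop (μ := μ)
    (s := fun n : ℕ => approximable b o G ξ Φ (n + 1))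
    (fun n => (measurableSet_approximable hG ξ Φ _).nullMeasurableSet)
    (fun m n hmn => approximable_anti hb hΦ hΦ' (by positivity) (by
      have : (m : ℝ) ≤ n := Nat.cast_le.2 hmn
      linarith)) ⟨0, measure_ne_top _ _⟩
  rw [h] at h1
  obtain ⟨n, hn⟩ := ((tendsto_order.1 h1).2 ε (pos_iff_ne_zero.2 hε)).exists
  exact ⟨n + 1, by linarith [n.cast_nonneg (α := ℝ)], hn.le⟩

/-- The heart of the divergence case: if the approximable set is null, smallness of U_K₁ propagates
through every u in T to all scales and feeds the packing inequality. -/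
theorem exists_tsum_khinchinTerm_ne_top (hb : 1 < b) (hC : BoundaryGeometry X b o C)
    (hG : StronglyDiscrete o G) {ξ : GromovBoundary X} {δ : ℝ} (hδ : 0 < δ)
    {μ : Measure (GromovBoundary X)} [IsFiniteMeasure μ] (hqc : IsQuasiconformal b o G δ μ)
    {Φ : ℝ → ℝ} (hΦ : ∀ t, 0 < t → 0 < Φ t) (hΦ' : AntitoneOn (fun t => t * Φ t) (Ioi 0))
    (hnull : μ (⋂ n : ℕ, approximable b o G ξ Φ (n + 1)) = 0) {M : ℝ} (hM : 1 ≤ M) :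
    ∃ K : ℝ, 0 < K ∧
      ∑' g, (contracting b o G ξ M).indicator (khinchinTerm b o δ μ ξ Φ K) g ≠ ∞ := by
  classical
  have hC0 := hC.pos
  have hC1 := hC.one_le
  obtain ⟨Q, hQ⟩ := hqc.exists_bounds hb hδ.le
  set T := contracting b o G ξ M
  have hl : ∀ g : X ≃ᵢ X, 0 < expDisp b o g := fun g => expDisp_pos hb g
  have hl1 : ∀ g : X ≃ᵢ X, 1 ≤ expDisp b o g := fun g => one_le_expDisp hb g
  have hΦ1 : 0 < Φ 1 := hΦ 1 one_pos
  have hCM : 1 ≤ C * M := one_le_mul_of_one_le_of_one_le hC1 hM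
  -- Small enough for `dist_map_le_of_near` on B(ξ,r₀) and for κ = C M r₀ ≤ 1/100.
  obtain ⟨r₀, hr₀⟩ : ∃ r₀, r₀ = 1 / (100 * (C * M + 1)) := ⟨_, rfl⟩
  have hr0 : 0 < r₀ := by rw [hr₀]; positivity
  have hr1 : r₀ * (C * M + 1) = 1 / 100 := by rw [hr₀]; field_simp
  have hradius : ∀ K, 1 ≤ K → Φ 1 / r₀ ≤ K → ∀ g : X ≃ᵢ X,
      expDisp b o g * Φ (K * expDisp b o g) ≤ r₀ := by
    intro K hK hK' g
    have h1 : K * expDisp b o g * Φ (K * expDisp b o g) ≤ Φ 1 :=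
      mul_le_of_antitoneOn_mul hΦ hΦ' (one_le_mul_of_one_le_of_one_le hK (hl1 g)) one_pos
        (by rw [mul_one])
    rw [div_le_iff₀ hr0] at hK'
    refine le_of_mul_le_mul_left ?_ (one_pos.trans_le hK)
    linarith
  -- If a ball around ξ is null, every term vanishes for large K. Otherwise its positive measure
  -- gives the lower bound for μ(P u).
  by_cases hm : μ (Metric.closedBall ξ r₀) = 0
  · obtain ⟨K, hK⟩ : ∃ K, K = max 1 (Φ 1 / r₀) := ⟨_, rfl⟩
    have hK1 : 1 ≤ K := hK ▸ le_max_left _ _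
    have hK2 : Φ 1 / r₀ ≤ K := hK ▸ le_max_right _ _
    refine ⟨K, by linarith, ?_⟩
    have h0 : ∀ g, T.indicator (khinchinTerm b o δ μ ξ Φ K) g = 0 := by
      intro g
      refine indicator_apply_eq_zero.2 fun _ => ?_
      rw [khinchinTerm, measure_mono_null
        (Metric.closedBall_subset_closedBall (hradius K hK1 hK2 g)) hm, mul_zero]
    simp [h0]
  obtain ⟨A, hA, hAsum⟩ := hC.exists_sum_le hb hG hM ξ hδ
  have hc0 : 0 < 4 * C ^ 3 * M := by positivity
  -- Twice the product of all quasiconformal and geometric constants that appear when the measure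
  -- below u is compared with μ(P u).
  obtain ⟨ε, hε0, hε⟩ : ∃ ε : ℝ≥0, 0 < ε ∧ ε * (2 * Q * Q * ENNReal.ofReal ((4 * C ^ 3 * M) ^ δ) *
      ENNReal.ofReal (C ^ δ)) < μ (Metric.closedBall ξ r₀) :=
    ENNReal.exists_nnreal_pos_mul_lt (by finiteness) hm
  obtain ⟨K₁, hK₁, hUε⟩ := exists_measure_approximable_le hb hG hΦ hΦ' hnull
    (ε := ε) (by exact_mod_cast hε0.ne')
  -- The first two bounds force l_g Φ(K l_g) ≤ r₀, that is E g ⊆ P g; the last sends the points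
  -- below u into U_K₁ under u⁻¹.
  obtain ⟨K, hK⟩ : ∃ K, K = max (max 1 (Φ 1 / r₀))
    (7 * C ^ 2 * (C * M) * (4 * C ^ 3 * M) * K₁) := ⟨_, rfl⟩
  have hK1 : 1 ≤ K := hK ▸ (le_max_left _ _).trans (le_max_left _ _)
  have hK2 : Φ 1 / r₀ ≤ K := hK ▸ (le_max_right _ _).trans (le_max_left _ _)
  have hK3 : 7 * C ^ 2 * (C * M) * (4 * C ^ 3 * M) * K₁ ≤ K := hK ▸ le_max_right _ _
  have hK0 : 0 < K := by linarith
  have hradius := hradius K hK1 hK2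
  have hΦp : ∀ g : X ≃ᵢ X, 0 < Φ (K * expDisp b o g) := fun g => hΦ _ (mul_pos hK0 (hl g))
  have hΦanti : ∀ g h : X ≃ᵢ X, expDisp b o g ≤ expDisp b o h →
      Φ (K * expDisp b o h) ≤ Φ (K * expDisp b o g) := fun g h hgh => by
    have := mul_le_of_antitoneOn_mul hΦ hΦ' le_rfl (mul_pos hK0 (hl g))
      (t' := K * expDisp b o h) (by rw [one_mul]; gcongr)
    linarith
  let P : (X ≃ᵢ X) → Set (GromovBoundary X) := fun g => boundaryMap g '' Metric.closedBall ξ r₀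
  let E : (X ≃ᵢ X) → Set (GromovBoundary X) := fun g =>
    boundaryMap g '' Metric.closedBall ξ (expDisp b o g * Φ (K * expDisp b o g))
  let e : (X ≃ᵢ X) → ℝ := fun g => (expDisp b o g)⁻¹
  -- Normalised so that κ s g = C M Φ(K l_g), the radius of a ball containing E g.
  let s : (X ≃ᵢ X) → ℝ := fun g => Φ (K * expDisp b o g) / r₀
  have he : ∀ {g h}, e h ≤ e g ↔ expDisp b o g ≤ expDisp b o h := fun {g h} =>
    inv_le_inv₀ (hl h) (hl g)
  set κ := C * M * r₀ with hκ
  have hκ0 : 0 ≤ κ := by positivity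
  have hκ1 : κ ≤ 1 / 100 := by rw [← hr1, hκ, mul_comm]; gcongr; linarith
  have hκs : ∀ g, κ * s g = C * M * Φ (K * expDisp b o g) := fun g => by
    simp only [hκ, s]; field_simp
  have hball : ∀ g ∈ T, ∀ r ≤ r₀, boundaryMap g '' Metric.closedBall ξ r ⊆
      Metric.closedBall (boundaryMap g ξ) (C * M * r * e g) := by
    rintro g hg r hr _ ⟨η, hη, rfl⟩
    have hη' : dist η ξ ≤ r := hη
    have h1 := hC.dist_map_le_of_near hb hM hg (η := η) (by
      calc dist η ξ * (C * M + 1) ≤ r₀ * (C * M + 1) := by gcongr; linarith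
        _ ≤ 1 := by rw [hr1]; norm_num)
    rw [Metric.mem_closedBall, ← div_eq_mul_inv, le_div_iff₀ (hl g)]
    refine h1.trans ?_
    gcongr
  have hse : ∀ g, s g ≤ e g := fun g => by
    simp only [s, e]
    rw [div_le_iff₀ hr0, inv_mul_eq_div, le_div_iff₀ (hl g), mul_comm]
    exact hradius g
  -- the part of the family below `u` fills a small portion of `P u`
  have hsmall : ∀ F : Finset (X ≃ᵢ X), (∀ g ∈ F, g ∈ T) → ∀ u ∈ F,
      μ (⋃ h ∈ {h | h ∈ F ∧ e h ≤ e u ∧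
        dist (boundaryMap h ξ) (boundaryMap u ξ) ≤ 2 * κ * e u},
        Metric.closedBall (boundaryMap h ξ) (7 * κ * s h)) ≤ μ (P u) / 2 := by
    intro F hF u hu
    set V := ⋃ h ∈ {h | h ∈ F ∧ e h ≤ e u ∧
        dist (boundaryMap h ξ) (boundaryMap u ξ) ≤ 2 * κ * e u},
        Metric.closedBall (boundaryMap h ξ) (7 * κ * s h) with hV
    have hVm : MeasurableSet V :=
      (F.finite_toSet.subset fun q hq => hq.1).measurableSet_biUnion
        fun q hq => measurableSet_closedBall
    have heu : 0 < e u := inv_pos.2 (hl u)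
    have hVy : ∀ y ∈ V, dist y (boundaryMap u ξ) * expDisp b o u ≤ 2 ∧
        boundaryMap u⁻¹ y ∈ approximable b o G ξ Φ K₁ := by
      intro y hy
      simp only [hV, mem_iUnion] at hy
      obtain ⟨h, ⟨hh, hhe, hhd⟩, hyh⟩ := hy
      have hyh' : dist y (boundaryMap h ξ) ≤ 7 * κ * s h := hyh
      have hle := he.1 hhe
      have h1 : κ * s h ≤ κ * e u := by gcongr; exact (hse h).trans hhe
      have h2 : κ * e u ≤ 1 / 100 * e u := by gcongr
      have h3 : e u * expDisp b o u = 1 := inv_mul_cancel₀ (hl u).ne'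
      have h4 : dist (boundaryMap h ξ) (boundaryMap u ξ) * expDisp b o u ≤ 2 := by
        calc _ ≤ (2 * e u) * expDisp b o u := by
              have := hl u
              gcongr; linarith
          _ = 2 := by rw [mul_assoc, h3, mul_one]
      constructor
      · have h5 := dist_triangle y (boundaryMap h ξ) (boundaryMap u ξ)
        calc _ ≤ (2 * e u) * expDisp b o u := by
              have := hl u
              gcongr; linarith
          _ = 2 := by rw [mul_assoc, h3, mul_one]
      · have huG := (hF u hu).1
        refine mem_approximable.2 ⟨u⁻¹ * h, G.mul_mem (G.inv_mem huG) (hF h hh).1, ?_⟩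
        rw [boundaryMap_mul, dist_comm]
        have h6 := hC.dist_map_le hb u⁻¹ y (boundaryMap h ξ)
        rw [expDisp_inv] at h6
        have h7 := hC.expDisp_inv_mul_le hb hM (hF u hu) (hF h hh) hle h4
        have hlu := hl u
        have hlk := hl (u⁻¹ * h)
        calc dist (boundaryMap u⁻¹ y) (boundaryMap u⁻¹ (boundaryMap h ξ))
            ≤ C ^ 2 * expDisp b o u * (7 * (C * M * Φ (K * expDisp b o h))) := by
              refine h6.trans ?_
              rw [← hκs, ← mul_assoc 7]
              gcongr
          _ = 7 * C ^ 2 * (C * M) * expDisp b o u * Φ (K * expDisp b o h) := by ring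
          -- The Lipschitz factor l_u of u⁻¹ is compensated by the displacement of u⁻¹h, which is at
          -- most a constant times l_h / l_u.
          _ ≤ Φ (K₁ * expDisp b o (u⁻¹ * h)) := by
              refine mul_le_of_antitoneOn_mul hΦ hΦ' ?_ (by positivity) ?_
              · refine one_le_mul_of_one_le_of_one_le (one_le_mul_of_one_le_of_one_le ?_ hCM)
                  (hl1 u)
                nlinarith
              · calc 7 * C ^ 2 * (C * M) * expDisp b o u * (K₁ * expDisp b o (u⁻¹ * h))
                    = 7 * C ^ 2 * (C * M) * K₁ * (expDisp b o (u⁻¹ * h) * expDisp b o u) := by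
                      ring
                  _ ≤ 7 * C ^ 2 * (C * M) * K₁ * (4 * C ^ 3 * M * expDisp b o h) := by gcongr
                  _ = 7 * C ^ 2 * (C * M) * (4 * C ^ 3 * M) * K₁ * expDisp b o h := by ring
                  _ ≤ K * expDisp b o h := by
                    have := hl h
                    gcongr
    have himg : boundaryMap u '' (boundaryMap u⁻¹ '' V) = V := by
      rw [← image_comp]
      convert image_id _
      funext η
      exact boundaryMap_apply_inv u η
    have hup := (hQ u (hF u hu).1 (boundaryMap u⁻¹ '' V) (hC.measurableSet_image hb _ hVm)
      (4 * C ^ 3 * M * (expDisp b o u)⁻¹) (by have := hl u; positivity)).1 (by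
        rintro _ ⟨y, hy, rfl⟩
        exact hC.deriv_le_of_near_image hb hM (hF u hu) (hVy y hy).1)
    have hVε : μ (boundaryMap u⁻¹ '' V) ≤ ε := by
      refine (measure_mono ?_).trans hUε
      rintro _ ⟨y, hy, rfl⟩
      exact (hVy y hy).2
    have hlow := (hQ u (hF u hu).1 (Metric.closedBall ξ r₀) measurableSet_closedBall
      (C⁻¹ * (expDisp b o u)⁻¹) (by have := hl u; positivity)).2 (by
        intro η _
        rw [← mul_inv, inv_le_iff_one_le_mul₀ (mul_pos hC0 (hl u))]
        have := hC.one_le_deriv_mul u η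
        linarith)
    rw [himg] at hup
    rw [Real.mul_rpow (by positivity) (inv_pos.2 (hl u)).le,
      ENNReal.ofReal_mul (by positivity)] at hup hlow
    set L := ENNReal.ofReal ((expDisp b o u)⁻¹ ^ δ) with hL
    have hL0 : L ≠ 0 := (ENNReal.ofReal_pos.2 (Real.rpow_pos_of_pos (inv_pos.2 (hl u)) _)).ne'
    have hCC : ENNReal.ofReal (C⁻¹ ^ δ) * ENNReal.ofReal (C ^ δ) = 1 := by
      rw [← ENNReal.ofReal_mul (by positivity), ← Real.mul_rpow (by positivity) hC0.le,
        inv_mul_cancel₀ hC0.ne', Real.one_rpow, ENNReal.ofReal_one]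
    have hc2 : ENNReal.ofReal (C⁻¹ ^ δ) ≠ 0 := fun h => by
      rw [h, zero_mul] at hCC; exact zero_ne_one hCC
    have hQ0 : (Q : ℝ≥0∞) ≠ 0 := fun h => by
      rw [h, zero_mul] at hlow
      exact mul_ne_zero (mul_ne_zero hc2 hL0) hm (le_antisymm hlow bot_le)
    rw [ENNReal.le_div_iff_mul_le (by norm_num) (by norm_num)]
    refine (ENNReal.mul_le_mul_iff_right hQ0 ENNReal.coe_ne_top).1 ?_
    calc Q * (μ V * 2)
        ≤ Q * (Q * (ENNReal.ofReal ((4 * C ^ 3 * M) ^ δ) * L) * ε * 2) := by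
          gcongr
          exact hup.trans (by gcongr)
      _ = ENNReal.ofReal (C⁻¹ ^ δ) * L * (ε * (2 * Q * Q * ENNReal.ofReal ((4 * C ^ 3 * M) ^ δ) *
            ENNReal.ofReal (C ^ δ))) := by
          rw [← mul_one (Q * (Q * (ENNReal.ofReal ((4 * C ^ 3 * M) ^ δ) * L) * ε * 2)), ← hCC]
          ring
      _ ≤ ENNReal.ofReal (C⁻¹ ^ δ) * L * μ (Metric.closedBall ξ r₀) := by gcongr
      _ ≤ Q * μ (P u) := hlow
  have hterm : ∀ g ∈ T, khinchinTerm b o δ μ ξ Φ K g ≤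
      ENNReal.ofReal (C ^ δ) * Q * μ (E g) := by
    intro g hg
    have hlow := (hQ g hg.1 (Metric.closedBall ξ (expDisp b o g * Φ (K * expDisp b o g)))
      measurableSet_closedBall
      (C⁻¹ * (expDisp b o g)⁻¹) (by have := hl g; positivity)).2 (by
        intro η _
        rw [← mul_inv, inv_le_iff_one_le_mul₀ (mul_pos hC0 (hl g))]
        have := hC.one_le_deriv_mul g η
        linarith)
    rw [mul_assoc]
    refine le_trans (le_of_eq ?_) (mul_le_mul_right hlow _)
    rw [khinchinTerm, ← mul_assoc, ← ENNReal.ofReal_mul (by positivity),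
      ← Real.mul_rpow hC0.le (by have := hl g; positivity), ← mul_assoc, mul_inv_cancel₀ hC0.ne',
      one_mul, Real.inv_rpow (hl g).le, Real.rpow_neg (hl g).le]
  have hψ : AntitoneOn (fun t : ℝ => μ (Metric.closedBall ξ (t * Φ (K * t)))) (Ioi 0) := by
    intro t ht t' ht' htt
    refine measure_mono (Metric.closedBall_subset_closedBall ?_)
    have h1 : K * t' * Φ (K * t') ≤ K * t * Φ (K * t) :=
      hΦ' (mul_pos hK0 ht) (mul_pos hK0 ht') (mul_le_mul_of_nonneg_left htt hK0.le)
    refine le_of_mul_le_mul_left ?_ hK0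
    linarith
  have hbound : ∀ F : Finset (X ≃ᵢ X), (∀ g ∈ F, g ∈ T) →
      ∑ g ∈ F, khinchinTerm b o δ μ ξ Φ K g ≤
        (1 + A) * (ENNReal.ofReal (C ^ δ) * Q * (2 * μ univ)) := by
    intro F hF
    -- The packing inequality is applied to S; each discarded t is charged to a chosen s with t in
    -- `N s`, and `hAsum` bounds the total charge.
    obtain ⟨S, hSF, hSsep, hScov⟩ := exists_separated_subset (fun g => boundaryMap g ξ) e F
    have hST : ∀ g ∈ S, g ∈ T := fun g hg => hF g (hSF hg)
    have hpack := sum_measure_le_of_packing (μ := μ) (x := fun g => boundaryMap g ξ) (e := e)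
      (s := s) (P := P) (E := E) hκ0 hκ1 S
      (fun g _ => hC.measurableSet_image hb g measurableSet_closedBall)
      (fun g _ => hC.measurableSet_image hb g measurableSet_closedBall)
      (fun g hg => hball g (hST g hg) r₀ le_rfl)
      (fun g _ => image_mono (Metric.closedBall_subset_closedBall (hradius g)))
      (fun g hg => by
        rw [hκs]
        convert hball g (hST g hg) _ (hradius g) using 2
        have := (hl g).ne'
        simp only [e]
        field_simp)
      (fun g _ => div_pos (hΦp g) hr0) (fun g _ => hse g)
      (fun g _ h _ hle => div_le_div_of_nonneg_right (hΦanti g h (he.1 hle)) hr0.le)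
      hSsep (hsmall S hST)
    have hmem : ∀ t ∈ F, ∃ s ∈ S, t = s ∨ t ∈ F.filter fun t => e t ≤ e s ∧
        dist (boundaryMap s ξ) (boundaryMap t ξ) ≤ e t := by
      intro t ht
      obtain ⟨s, hs, h | h⟩ := hScov t ht
      · exact ⟨s, hs, .inl h⟩
      · exact ⟨s, hs, .inr (Finset.mem_filter.2 ⟨ht, h⟩)⟩
    let N : (X ≃ᵢ X) → Finset (X ≃ᵢ X) := fun s => F.filter fun t => e t ≤ e s ∧
      dist (boundaryMap s ξ) (boundaryMap t ξ) ≤ e t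
    calc ∑ g ∈ F, khinchinTerm b o δ μ ξ Φ K g
        ≤ ∑ g ∈ S.biUnion fun s => insert s (N s), khinchinTerm b o δ μ ξ Φ K g := by
          refine Finset.sum_le_sum_of_subset fun t ht => ?_
          obtain ⟨s, hs, hst⟩ := hmem t ht
          exact Finset.mem_biUnion.2 ⟨s, hs, Finset.mem_insert.2 hst⟩
      _ ≤ ∑ s ∈ S, ∑ g ∈ insert s (N s), khinchinTerm b o δ μ ξ Φ K g :=
          sum_biUnion_le _ _ _
      _ ≤ ∑ s ∈ S, (1 + A) * khinchinTerm b o δ μ ξ Φ K s := by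
          refine Finset.sum_le_sum fun s hs => ?_
          have h1 : ∑ g ∈ N s, khinchinTerm b o δ μ ξ Φ K g ≤
              A * khinchinTerm b o δ μ ξ Φ K s := by
            refine hAsum _ hψ (N s) s fun h hh => ?_
            obtain ⟨hh, hle, hd⟩ := Finset.mem_filter.1 hh
            exact ⟨hF h hh, he.1 hle, hd⟩
          have h2 : ∑ g ∈ insert s (N s), khinchinTerm b o δ μ ξ Φ K g ≤
              khinchinTerm b o δ μ ξ Φ K s + ∑ g ∈ N s, khinchinTerm b o δ μ ξ Φ K g := by
            by_cases h : s ∈ N s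
            · rw [Finset.insert_eq_of_mem h]; exact le_add_self
            · rw [Finset.sum_insert h]
          refine h2.trans ?_
          rw [add_mul, one_mul]
          gcongr
      _ ≤ ∑ s ∈ S, (1 + A) * (ENNReal.ofReal (C ^ δ) * Q * μ (E s)) := by
          gcongr with s hs
          exact hterm s (hST s hs)
      _ = (1 + A) * (ENNReal.ofReal (C ^ δ) * Q * ∑ s ∈ S, μ (E s)) := by
          rw [← Finset.mul_sum, ← Finset.mul_sum]
      _ ≤ _ := by gcongr
  refine ⟨K, hK0, ne_top_of_le_ne_top (b := (1 + A) * (ENNReal.ofReal (C ^ δ) * Q * (2 * μ univ)))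
    (by finiteness) ?_⟩
  rw [ENNReal.tsum_eq_iSup_sum]
  refine iSup_le fun F => ?_
  rw [Finset.sum_indicator_eq_sum_filter]
  exact hbound _ fun g hg => (Finset.mem_filter.1 hg).2

/-- The divergence case. -/
theorem measure_wellApproximable_eq_one (hb : 1 < b) (hvis : IsVisualMetric X b o)
    (hG : StronglyDiscrete o G) (hG' : IsGeneralType G) {ξ : GromovBoundary X} {δ : ℝ}
    (hδ : 0 ≤ δ) {μ : Measure (GromovBoundary X)} [IsProbabilityMeasure μ]
    (hμΛ : μ (limitSet o G)ᶜ = 0) (hqc : IsQuasiconformal b o G δ μ) (herg : IsErgodic G μ)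
    {Φ : ℝ → ℝ} (hΦ : ∀ t, 0 < t → 0 < Φ t) (hΦ' : AntitoneOn (fun t => t * Φ t) (Ioi 0))
    (hdiv : ∀ K : ℝ, 0 < K → khinchinSeries b o G δ μ ξ Φ K = ∞) :
    μ (wellApproximable b o G ξ Φ) = 1 := by
  obtain ⟨C, hC⟩ := exists_boundaryGeometry hb hvis
  have hδ' : 0 < δ := hδ.lt_of_ne fun h => hG'.exponent_ne_zero hb (μ := μ) (o := o) (h ▸ hqc)
  have hmeas : MeasurableSet (⋂ n : ℕ, approximable b o G ξ Φ (n + 1)) :=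
    MeasurableSet.iInter fun n => measurableSet_approximable hG ξ Φ _
  rcases herg _ hmeas fun g hg => image_iInter_approximable hb hC hΦ hΦ' hg with h | h
  · exfalso
    obtain ⟨f, hf, hfξ⟩ := hG'.exists_boundaryMap_ne ξ
    obtain ⟨M, hM, hMG⟩ := exists_contracting hb hC hf hfξ
    obtain ⟨K, hK, hsum⟩ := exists_tsum_khinchinTerm_ne_top hb hC hG hδ' hqc hΦ hΦ' h hM
    refine ne_top_of_le_ne_top ?_ (khinchinSeries_le (μ := μ) hb hδ hΦ hΦ' hK hMG)
      (hdiv _ (mul_pos hK (expDisp_pos hb f)))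
    finiteness
  · have hsub : (wellApproximable b o G ξ Φ)ᶜ ⊆
        (limitSet o G)ᶜ ∪ (⋂ n : ℕ, approximable b o G ξ Φ (n + 1))ᶜ := by
      rw [← compl_inter, compl_subset_compl]
      rintro η ⟨hηΛ, hη⟩
      refine ⟨hηΛ, fun K hK => ?_⟩
      obtain ⟨n, hn⟩ := exists_nat_ge K
      exact mem_approximable.1 (approximable_anti hb hΦ hΦ' hK (by linarith)
        (mem_iInter.1 hη n))
    have hnull := measure_mono_null hsub (measure_union_null hμΛ h)
    have hae : wellApproximable b o G ξ Φ =ᵐ[μ] (univ : Set (GromovBoundary X)) := by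
      rw [ae_eq_univ]; exact hnull
    rw [measure_congr hae, measure_univ]

end Divergence

end GromovKhinchin

theorem mainTheorem7 {X : Type*} [MetricSpace X] [GromovKhinchin.GromovHyperbolic X]
    [MetricSpace (GromovKhinchin.GromovBoundary X)]
    [MeasurableSpace (GromovKhinchin.GromovBoundary X)]
    [BorelSpace (GromovKhinchin.GromovBoundary X)]
    (o : X) (b : ℝ) (hb : 1 < b) (hvis : GromovKhinchin.IsVisualMetric X b o)
    (G : Subgroup (X ≃ᵢ X)) (hG : GromovKhinchin.StronglyDiscrete o G)
    (hG' : GromovKhinchin.IsGeneralType G)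
    (ξ : GromovKhinchin.GromovBoundary X)
    (δ : ℝ≥0) (hδ : GromovKhinchin.poincareExponent b o G = δ)
    (μ : Measure (GromovKhinchin.GromovBoundary X)) (hμ : IsProbabilityMeasure μ)
    (hμΛ : μ (GromovKhinchin.limitSet o G)ᶜ = 0)
    (hqc : GromovKhinchin.IsQuasiconformal b o G δ μ)
    (herg : GromovKhinchin.IsErgodic G μ) (hμξ : μ {ξ} = 0)
    (Φ : ℝ → ℝ) (hΦ : ∀ t, 0 < t → 0 < Φ t)
    (hΦ' : AntitoneOn (fun t => t * Φ t) (Ioi 0)) :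
    ((∀ K : ℝ, 0 < K → GromovKhinchin.khinchinSeries b o G δ μ ξ Φ K = ∞) →
      μ (GromovKhinchin.wellApproximable b o G ξ Φ) = 1) ∧
    ((∃ K : ℝ, 0 < K ∧ GromovKhinchin.khinchinDerivSeries b o G δ μ ξ Φ K < ∞) →
      μ (GromovKhinchin.wellApproximable b o G ξ Φ) = 0) ∧
    (GromovKhinchin.IsBoundedParabolicPoint b o G ξ →
      (∃ K : ℝ, 0 < K ∧ GromovKhinchin.khinchinSeries b o G δ μ ξ Φ K < ∞) →
      μ (GromovKhinchin.wellApproximable b o G ξ Φ) = 0) := by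
  have := hμ
  refine ⟨fun hdiv => ?_, ?_, ?_⟩
  · exact GromovKhinchin.measure_wellApproximable_eq_one hb hvis hG hG' δ.2 hμΛ hqc herg hΦ hΦ'
      hdiv
  · rintro ⟨K, hK, hsum⟩
    exact GromovKhinchin.measure_wellApproximable_eq_zero_of_derivSeries hb hvis hG δ.2 hqc hμξ
      hΦ hΦ' hK hsum
  · rintro hpar ⟨K, hK, hsum⟩
    exact GromovKhinchin.measure_wellApproximable_eq_zero_of_boundedParabolic hb hvis hG δ.2 hqc
      hμξ hΦ hΦ' hpar hK hsum
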